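/- **Notation.** Let $\mathcal N=\mathbb N^{\mathbb N}$ with $d(x,y)=2^{-n}$ for distinct $x,y$, where $n$ is least with $x(n)\neq y(n)$. For $n\in\mathbb N$ let $\mathcal N_n=\{x\in\mathcal N: x(m)=0 \text{ for all } m\ge n\}$, let $\pi_n(x)\in\mathcal N_n$ agree with $x$ below $n$ and vanish from $n$ on, let $\mathcal N_\omega=\bigcup_n\mathcal N_n$, and let $\hat 0$ be the zero sequence. For a set $X$ put $\overline X=X\sqcup X^{-1}\sqcup\{e\}$, with $(x^{-1})^{-1}=x$, $e^{-1}=e$. For $X\subseteq\mathcal N$, $d$ is extended to an ultrametric on $\overline X$ by $d(x^{-1},y^{-1})=d(x,y)$ and $d(x,e)=d(x^{-1},e)=d(x,y^{-1})=1$ for $x,y\in X$. The maps $\pi_n$ are extended by $\pi_n(x^{-1})=\pi_n(x)^{-1}$, $\pi_n(e)=e$. A *scale* on $\overline X$ is a function $\Gamma:\overline X\times[0,\infty)\to[0,\infty)$ such that, for all $x,r$: $\Gamma(e,r)=r\le\Gamma(x,r)$; $\Gamma(x,r)=0$ iff $r=0$; $\Gamma(x,\cdot)$ is non-decreasing; and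 $\lim_{r\to0}\Gamma(x,r)=0$. A *match* on a finite interval $I$ of integers is a bijection $\theta$ of $I$ with $\theta\circ\theta=\mathrm{id}$ and with no $i,j\in I$ such that $i<j<\theta(i)<\theta(j)$. For a nonempty word $w$ of length $l+1$ over $\overline X$ and a match $\theta$ on $\{0,\dots,l\}$ (restrictions of $\theta$ being re-indexed to start at $0$), define recursively $N^\theta_\Gamma(w)$ as: $d(e,x)$ if $w=x$; $d(x,y)$ if $w=x^{-1}y$ and $\theta(0)=1$; $N^{\theta_1}_\Gamma(w_1)+N^{\theta_2}_\Gamma(w_2)$ if $\theta(0)=k<l$ and $w=w_1w_2$ with $w_1$ of length $k+1$, where $\theta_1,\theta_2$ are the restrictions of $\theta$ to $\{0,\dots,k\}$ and $\{k+1,\dots,l\}$; and $d(x,y)+\min\{\Gamma(x,N^{\theta_1}_\Gamma(w_1)),\Gamma(y,N^{\theta_1}_\Gamma(w_1))\}$ if $l>1$, $\theta(0)=l$ and $w=x^{-1}w_1y$, where $\theta_1$ is the restriction of $\theta$ to $\{1,\dots,l-1\}$. For $g$ in the free group $F(X)$ let $N_\Gamma(g)$ be the infimum of $N^\theta_\Gamma(w)$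 over all nonempty words $w$ over $\overline X$ that represent $g$ and all matches $\theta$. Put $\delta_\Gamma(g,h)=N_\Gamma(g^{-1}h)$ and $\Delta_\Gamma(g,h)=\max\{\delta_\Gamma(g,h),\delta_\Gamma(g^{-1},h^{-1})\}$; $\overline F_\Gamma(X)$ is the completion of $(F(X),\Delta_\Gamma)$, a topological group with the operations extended by continuity. A scale $\Gamma$ is *adequate* if for all $x,y,z\in\overline X$ and $r_1,r_2\ge0$: - (A1) $\min\{\Gamma(x,r_1),\Gamma(z,r_1)\}+d(x,z)+\min\{\Gamma(y,r_2),\Gamma(z,r_2)\}+d(y,z)\ge\min\{\Gamma(x,r_1+r_2),\Gamma(y,r_1+r_2)\}+d(x,y)$; - (A2) $\min\{\Gamma(x,r),\Gamma(z,r)\}+d(x,z)\ge\min\{\Gamma(x,r_1),\Gamma(y,r_1)\}+d(x,y)+r_2$, where $r=r_1+\min\{\Gamma(y^{-1},r_2),\Gamma(z^{-1},r_2)\}+d(y,z)$. It is *good* if for all $x,y\in\overline X$ and $r,r_1,r_2\ge0$: (G1) $\Gamma(y,r)+d(x,y)\ge\Gamma(x,r)$; (G2) $r\mapsto\Gamma(x,r)/r$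 is non-increasing on $(0,\infty)$; (G3) $\Gamma(x,r_1+r_2)\ge\Gamma(x,r_1)+r_2$. A scale on $\overline{\mathcal N}$ is *regular* if $\Gamma(x,r)\ge\Gamma(\pi_n(x),r)$ for all $x\in\overline{\mathcal N}$, $r\ge0$, $n\in\mathbb N$. A Polish group is *surjectively universal* if it admits a continuous surjective homomorphism onto every Polish group. A set is $\mathbf\Pi^0_3$ if it is a countable intersection of countable unions of closed sets. $S_\infty$ is the group of permutations of $\mathbb N$ with the topology of pointwise convergence. The scale $\Gamma_0$ on $\overline{\mathcal N_\omega}$ is defined by $\Gamma_0(e,r)=\Gamma_0(\hat0,r)=\Gamma_0(\hat0^{-1},r)=r$ and, recursively for $m\ge1$ and $x\in\mathcal N_m\setminus\mathcal N_{m-1}$, $$\Gamma_0(x^{-1},r)=\Gamma_0(x,r)=\min\Big\{2^5\big(1+2^{x(0)}+2^{x(0)+x(1)}+\cdots+2^{x(0)+\cdots+x(m-1)}\big)r,\ \Gamma_0(\pi_{m-1}(x),r)+2^{-m}\Big\}.$$ **Statement.** 1. $\Gamma_0$ is good, and it is adequate. 2. $\Gamma_0(x^{-1},r)=\Gamma_0(x,r)$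 for all $x\in\overline{\mathcal N_\omega}$ and $r\ge0$, and, with $K=1$, for all $m>0$ and $k>m+K+5$: - (S1) for every $x\in\mathcal N_m\setminus\mathcal N_{m-1}$ and $r>2^{-(m+K+5)}$ there is $y\in\mathcal N_{m-1}$ with $\Gamma_0(x,r)\ge\min\{2^{-(K+3)},\Gamma_0(y,r)+2^{-K}d(x,y)\}$; - (S2) the set of all $x\in\mathcal N_m\setminus\mathcal N_{m-1}$ for which there is $r\in(2^{-k},2^{-(m+K+5)}]$ such that $\Gamma_0(x,r)<\min\{2^{-(K+3)},\Gamma_0(y,r)+2^{-K}d(x,y)\}$ for all $y\in\mathcal N_{m-1}$ is finite; - (S3) $\Gamma_0(x,r)\ge8r$ for every $x\in\mathcal N_m\setminus\mathcal N_{m-1}$ and $r\le2^{-(m+K+5)}$. 3. $\overline F_{\Gamma_0}(\mathcal N_\omega)$ is a surjectively universal Polish group. 4. For all $x\in\overline{\mathcal N}$ and $r\ge0$ the limit $\lim_{n\to\infty}\Gamma_0(\pi_n(x),r)$ exists, and these limits define a regular scale on $\overline{\mathcal N}$ that extends $\Gamma_0$. 5. Let $\varprojlim_n F(\mathcal N_n)$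 be the inverse limit of the discrete groups $F(\mathcal N_n)$ under the homomorphisms induced by the maps $\pi_n:\mathcal N_{n+1}\to\mathcal N_n$. The homomorphism $w\mapsto(\pi_n(w))_n$ on $F(\mathcal N_\omega)$ extends to a continuous injective homomorphism $\overline F_{\Gamma_0}(\mathcal N_\omega)\to\varprojlim_n F(\mathcal N_n)$ with $\mathbf\Pi^0_3$ range. 6. There are a $\mathbf\Pi^0_3$ subgroup $H$ of $S_\infty$ and a group isomorphism $\overline F_{\Gamma_0}(\mathcal N_\omega)\to H$ that is continuous (for the topology that $H$ inherits from $S_\infty$). -/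

import Mathlib

open Filter Topology
open scoped NNReal

universe u

noncomputable section

/-- The alphabet `X ∪ X⁻¹ ∪ {e}`. -/
inductive Letter (X : Type*) where
  | e : Letter X
  | pos : X → Letter X
  | neg : X → Letter X

namespace Letter

variable {X Y : Type*}

instance : Inv (Letter X) where
  inv a := match a with
    | e => e
    | pos x => neg x
    | neg x => pos x

theorem inv_inv' (a : Letter X) : a⁻¹⁻¹ = a := by
  cases a <;> rfl

/-- The map of alphabets induced by a map of the underlying sets. -/
def map (f : X → Y) : Letter X → Letter Y
  | e => e
  | pos x => pos (f x)
  | neg x => neg (f x)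

theorem map_injective {f : X → Y} (hf : Function.Injective f) :
    Function.Injective (map f) := by
  intro a b h
  cases a <;> cases b <;> simp_all [map, hf.eq_iff]

/-- The element of the free group denoted by a letter. -/
def toFree : Letter X → FreeGroup X
  | e => 1
  | pos x => FreeGroup.of x
  | neg x => (FreeGroup.of x)⁻¹

theorem toFree_inv (a : Letter X) : a⁻¹.toFree = a.toFree⁻¹ := by
  cases a with
  | e => exact inv_one.symm
  | pos x => rfl
  | neg x => exact (inv_inv _).symm

end Letter

/-- The element of the free group on `X` denoted by a word, that is, its reduced word. -/
def evalWord {X : Type*} (w : List (Letter X)) : FreeGroup X :=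
  (w.map Letter.toFree).prod

/-- A scale on the alphabet `X ∪ X⁻¹ ∪ {e}`. -/
structure Scale (X : Type*) where
  toFun : Letter X → ℝ≥0 → ℝ≥0
  map_e : ∀ r, toFun Letter.e r = r
  le_map : ∀ x r, r ≤ toFun x r
  eq_zero_iff : ∀ x r, toFun x r = 0 ↔ r = 0
  mono : ∀ x, Monotone (toFun x)
  tendsto_zero : ∀ x, Tendsto (toFun x) (𝓝 0) (𝓝 0)

instance {X : Type*} : CoeFun (Scale X) (fun _ => Letter X → ℝ≥0 → ℝ≥0) := ⟨Scale.toFun⟩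

/-- The distance on the alphabet is invariant under formal inversion. -/
class InvIsometric (X : Type*) [MetricSpace (Letter X)] : Prop where
  nndist_inv : ∀ a b : Letter X, nndist a⁻¹ b⁻¹ = nndist a b

/-- `θ` restricts to a match on `{0, …, n - 1}`: an involution of this set that has no pair
`i < j < θ i < θ j`. -/
structure IsMatch (n : ℕ) (θ : ℕ → ℕ) : Prop where
  lt : ∀ i < n, θ i < n
  invol : ∀ i < n, θ (θ i) = i
  noncrossing : ∀ i < n, ∀ j < n, ¬ (i < j ∧ j < θ i ∧ θ i < θ j)

section Norm

variable {X : Type*} [MetricSpace (Letter X)]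

/-- The pre-norm `N_Γ^θ(w)` of a nonempty word `w`, for a match `θ` on `{0, …, lh(w) - 1}`.
With `l + 1 = lh(w)`, the three branches for `l > 0` are `θ 0 < l`, then `l = 1` and `θ 0 = l`,
then `l > 1` and `θ 0 = l`; a restriction of `θ` to a subinterval is shifted to start at `0`. -/
def preNorm (Γ : Scale X) : List (Letter X) → (ℕ → ℕ) → ℝ≥0
  | [], _ => 0
  | [x], _ => nndist Letter.e x
  | a :: b :: t, θ =>
    if _h : θ 0 < t.length + 1 then
      preNorm Γ ((a :: b :: t).take (θ 0 + 1)) θ +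
        preNorm Γ ((a :: b :: t).drop (θ 0 + 1)) (fun i => θ (i + (θ 0 + 1)) - (θ 0 + 1))
    else if t = [] then nndist a⁻¹ b
    else
      let x := a⁻¹
      let y := (b :: t).getLast (List.cons_ne_nil b t)
      let r := preNorm Γ (b :: t).dropLast (fun i => θ (i + 1) - 1)
      nndist x y + min (Γ x r) (Γ y r)
termination_by w => w.length
decreasing_by
  all_goals simp_all; try omega

/-- The norm `N_Γ(g)`: the infimum of the pre-norms over all matches and all nonempty words
whose reduced word is `g`. -/
def wordNorm (Γ : Scale X) (g : FreeGroup X) : ℝ≥0 :=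
  sInf {r | ∃ w : List (Letter X), ∃ θ : ℕ → ℕ,
    w ≠ [] ∧ evalWord w = g ∧ IsMatch w.length θ ∧ preNorm Γ w θ = r}

theorem preNorm_split (Γ : Scale X) (w : List (Letter X)) (θ : ℕ → ℕ) (h : θ 0 + 1 < w.length) :
    preNorm Γ w θ = preNorm Γ (w.take (θ 0 + 1)) θ +
        preNorm Γ (w.drop (θ 0 + 1)) (fun i => θ (i + (θ 0 + 1)) - (θ 0 + 1)) := by
  match w, h with
  | a :: b :: t, h =>
    rw [preNorm, dif_pos]
    simpa using h

theorem preNorm_pair (Γ : Scale X) (a b : Letter X) (θ : ℕ → ℕ) (h : 0 < θ 0) :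
    preNorm Γ [a, b] θ = nndist a⁻¹ b := by
  rw [preNorm, dif_neg (by simpa using h.ne'), if_pos rfl]

theorem preNorm_wrap (Γ : Scale X) (a y : Letter X) (m : List (Letter X)) (hm : m ≠ [])
    (θ : ℕ → ℕ) (h : m.length < θ 0) :
    preNorm Γ (a :: (m ++ [y])) θ = nndist a⁻¹ y +
      min (Γ a⁻¹ (preNorm Γ m (fun i => θ (i + 1) - 1)))
        (Γ y (preNorm Γ m (fun i => θ (i + 1) - 1))) := by
  match m, hm with
  | b :: t, _ =>
    rw [List.cons_append, preNorm, dif_neg (by simp at h ⊢; omega), if_neg (by simp)]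
    have h1 : (b :: (t ++ [y])).dropLast = b :: t := by
      rw [← List.cons_append, List.dropLast_concat]
    have h2 : (b :: (t ++ [y])).getLast (List.cons_ne_nil _ _) = y := by
      simp
    simp only [h1, h2]

/-- Every nonempty word is a one-letter word, or is of the form `a m y`. -/
theorem word_cases (w : List (Letter X)) (hw : w ≠ []) :
    (∃ x, w = [x]) ∨ ∃ a m y, w = a :: (m ++ [y]) := by
  match w, hw with
  | [x], _ => exact Or.inl ⟨x, rfl⟩
  | a :: b :: t, _ =>
    refine Or.inr ⟨a, (b :: t).dropLast, (b :: t).getLast (List.cons_ne_nil b t), ?_⟩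
    rw [List.dropLast_append_getLast]

theorem preNorm_congr (Γ : Scale X) (n : ℕ) : ∀ (w : List (Letter X)) (θ θ' : ℕ → ℕ),
    w.length = n → (∀ i < n, θ i = θ' i) → preNorm Γ w θ = preNorm Γ w θ' := by
  induction n using Nat.strong_induction_on with
  | _ n ih =>
    intro w θ θ' hn h
    by_cases hw : w = []
    · subst hw; simp [preNorm]
    rcases word_cases w hw with ⟨x, rfl⟩ | ⟨a, m, y, rfl⟩
    · simp [preNorm]
    have hl : m.length + 2 = n := by simpa using hn
    have h0 := h 0 (by omega)
    by_cases hs : θ 0 + 1 < (a :: (m ++ [y])).length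
    · rw [preNorm_split Γ _ θ hs, preNorm_split Γ _ θ' (h0 ▸ hs), ← h0]
      congr 1
      · exact ih _ (by simp at hs ⊢; omega) _ _ _ rfl
          (fun i hi => h i (by simp at hs hi ⊢; omega))
      · refine ih _ ?_ _ _ _ rfl (fun i hi => ?_)
        · simp; omega
        · rw [h _ (by simp at hs hi ⊢; omega)]
    · simp at hs
      by_cases hm : m = []
      · subst hm
        simp at hl hs ⊢
        rw [preNorm_pair _ _ _ _ (by omega), preNorm_pair _ _ _ _ (by omega)]
      · have : preNorm Γ m (fun i => θ (i + 1) - 1) = preNorm Γ m (fun i => θ' (i + 1) - 1) := by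
          refine ih _ (by omega) _ _ _ rfl (fun i hi => ?_)
          rw [h _ (by omega)]
        rw [preNorm_wrap _ _ _ _ hm _ (by omega), preNorm_wrap _ _ _ _ hm _ (by omega), this]

theorem isMatch_take {n : ℕ} {θ : ℕ → ℕ} (h : IsMatch n θ) (h0 : θ 0 + 1 < n) :
    IsMatch (θ 0 + 1) θ := by
  have key : ∀ i < θ 0 + 1, θ i < θ 0 + 1 := by
    intro i hi
    by_contra hc
    rcases Nat.eq_zero_or_pos i with rfl | hpos
    · omega
    rcases Nat.lt_or_ge i (θ 0) with hlt | hge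
    · exact h.noncrossing 0 (by omega) i (by omega) ⟨hpos, hlt, by omega⟩
    · have : i = θ 0 := by omega
      subst this
      rw [h.invol 0 (by omega)] at hc
      omega
  exact ⟨key, fun i hi => h.invol i (by omega),
    fun i hi j hj => h.noncrossing i (by omega) j (by omega)⟩

theorem isMatch_drop {n : ℕ} {θ : ℕ → ℕ} (h : IsMatch n θ) (h0 : θ 0 + 1 < n) :
    IsMatch (n - (θ 0 + 1)) (fun i => θ (i + (θ 0 + 1)) - (θ 0 + 1)) := by
  have ht := isMatch_take h h0
  have key : ∀ i, θ 0 + 1 ≤ i → i < n → θ 0 + 1 ≤ θ i := by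
    intro i hi hin
    by_contra hc
    have := ht.lt (θ i) (by omega)
    rw [h.invol i hin] at this
    omega
  refine ⟨fun i hi => ?_, fun i hi => ?_, fun i hi j hj hij => ?_⟩
  · have := h.lt (i + (θ 0 + 1)) (by omega)
    omega
  · have h1 := key (i + (θ 0 + 1)) (by omega) (by omega)
    rw [Nat.sub_add_cancel h1, h.invol _ (by omega)]
    omega
  · have h1 := key (i + (θ 0 + 1)) (by omega) (by omega)
    have h2 := key (j + (θ 0 + 1)) (by omega) (by omega)
    exact h.noncrossing (i + (θ 0 + 1)) (by omega) (j + (θ 0 + 1)) (by omega)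
      ⟨by omega, by omega, by omega⟩

theorem isMatch_inner {n : ℕ} {θ : ℕ → ℕ} (h : IsMatch (n + 2) θ) (h0 : n < θ 0) :
    IsMatch n (fun i => θ (i + 1) - 1) := by
  have e0 : θ 0 = n + 1 := by have := h.lt 0 (by omega); omega
  have e1 : θ (n + 1) = 0 := by rw [← e0]; exact h.invol 0 (by omega)
  have key : ∀ i < n, 1 ≤ θ (i + 1) ∧ θ (i + 1) < n + 1 := by
    intro i hi
    have hl := h.lt (i + 1) (by omega)
    have hi2 := h.invol (i + 1) (by omega)
    constructor
    · by_contra hc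
      have : θ (i + 1) = 0 := by omega
      rw [this] at hi2; omega
    · by_contra hc
      have : θ (i + 1) = n + 1 := by omega
      rw [this] at hi2; omega
  refine ⟨fun i hi => ?_, fun i hi => ?_, fun i hi j hj hij => ?_⟩
  · have := key i hi
    omega
  · have := key i hi
    rw [Nat.sub_add_cancel this.1, h.invol _ (by omega)]; omega
  · have h1 := key i hi
    have h2 := key j hj
    exact h.noncrossing (i + 1) (by omega) (j + 1) (by omega) ⟨by omega, by omega, by omega⟩

/-- `r` is the pre-norm of the word `w` for some match. -/
def Realizes (Γ : Scale X) (w : List (Letter X)) (r : ℝ≥0) : Prop :=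
  ∃ θ, IsMatch w.length θ ∧ preNorm Γ w θ = r

theorem realizes_single (Γ : Scale X) (x : Letter X) : Realizes Γ [x] (nndist Letter.e x) :=
  ⟨id, ⟨fun _ h => h, fun _ _ => rfl, fun i _ j _ h => by simp only [id] at h; omega⟩,
    by simp [preNorm]⟩

theorem realizes_pair (Γ : Scale X) (a b : Letter X) : Realizes Γ [a, b] (nndist a⁻¹ b) := by
  refine ⟨fun i => 1 - i, ⟨fun i hi => ?_, fun i hi => ?_, fun i hi j hj h => ?_⟩,
    preNorm_pair _ _ _ _ (by simp)⟩ <;> simp at * <;> omega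

/-- Two matches side by side. -/
def glueMatch (k : ℕ) (θ₁ θ₂ : ℕ → ℕ) : ℕ → ℕ :=
  fun i => if i < k then θ₁ i else θ₂ (i - k) + k

theorem isMatch_glue {k l : ℕ} {θ₁ θ₂ : ℕ → ℕ} (h₁ : IsMatch k θ₁) (h₂ : IsMatch l θ₂) :
    IsMatch (k + l) (glueMatch k θ₁ θ₂) := by
  refine ⟨fun i hi => ?_, fun i hi => ?_, fun i hi j hj h => ?_⟩
  · unfold glueMatch
    split_ifs with hk
    · have := h₁.lt i hk; omega
    · have := h₂.lt (i - k) (by omega); omega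
  · unfold glueMatch
    by_cases hk : i < k
    · rw [if_pos hk, if_pos (h₁.lt i hk), h₁.invol i hk]
    · rw [if_neg hk, if_neg (by omega), Nat.add_sub_cancel, h₂.invol _ (by omega)]
      omega
  · unfold glueMatch at h
    by_cases hi' : i < k <;> by_cases hj' : j < k <;> simp only [hi', hj', if_true, if_false] at h
    · exact h₁.noncrossing i hi' j hj' h
    · have := h₁.lt i hi'; omega
    · omega
    · exact h₂.noncrossing (i - k) (by omega) (j - k) (by omega)
        ⟨by omega, by omega, by omega⟩

theorem preNorm_glue (Γ : Scale X) (n : ℕ) : ∀ (w v : List (Letter X)) (θ₁ θ₂ : ℕ → ℕ),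
    w.length = n → w ≠ [] → v ≠ [] → IsMatch n θ₁ →
    preNorm Γ (w ++ v) (glueMatch n θ₁ θ₂) = preNorm Γ w θ₁ + preNorm Γ v θ₂ := by
  induction n using Nat.strong_induction_on with
  | _ n ih =>
    intro w v θ₁ θ₂ hn hw hv h₁
    have hwl : 0 < w.length := List.length_pos_iff.2 hw
    have hvl : 0 < v.length := List.length_pos_iff.2 hv
    have hg0 : glueMatch n θ₁ θ₂ 0 = θ₁ 0 := by
      unfold glueMatch; rw [if_pos (by omega)]
    have h0 := h₁.lt 0 (by omega)
    rw [preNorm_split Γ (w ++ v) _ (by rw [hg0]; simp; omega)]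
    rw [hg0]
    by_cases hs : θ₁ 0 + 1 = n
    · congr 1
      · rw [hs, ← hn, List.take_left]
        exact preNorm_congr Γ n _ _ _ hn (fun i hi => by simp [glueMatch, hn, hi])
      · rw [hs, ← hn, List.drop_left]
        exact preNorm_congr Γ _ _ _ _ rfl (fun i hi => by simp [glueMatch])
    · have hlt : θ₁ 0 + 1 < n := by omega
      rw [preNorm_split Γ w θ₁ (by omega), add_assoc]
      congr 1
      · rw [List.take_append_of_le_length (by omega)]
        refine preNorm_congr Γ _ _ _ _ rfl (fun i hi => ?_)
        simp at hi
        simp only [glueMatch]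
        rw [if_pos (by omega)]
      · rw [List.drop_append_of_le_length (by omega)]
        have hd := isMatch_drop h₁ hlt
        rw [← ih (n - (θ₁ 0 + 1)) (by omega) (w.drop (θ₁ 0 + 1)) v _ θ₂ (by simp; omega)
          (by rw [← List.length_pos_iff]; simp; omega) hv hd]
        refine preNorm_congr Γ _ _ _ _ rfl (fun i hi => ?_)
        simp at hi
        simp only [glueMatch]
        by_cases hin : i < n - (θ₁ 0 + 1)
        · rw [if_pos hin, if_pos (by omega)]
        · rw [if_neg hin, if_neg (by omega),
            show i + (θ₁ 0 + 1) - n = i - (n - (θ₁ 0 + 1)) by omega]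
          omega

theorem realizes_append {Γ : Scale X} {w v : List (Letter X)} {r s : ℝ≥0} (hw : w ≠ [])
    (hv : v ≠ []) (h₁ : Realizes Γ w r) (h₂ : Realizes Γ v s) : Realizes Γ (w ++ v) (r + s) := by
  obtain ⟨θ₁, m₁, rfl⟩ := h₁
  obtain ⟨θ₂, m₂, rfl⟩ := h₂
  exact ⟨glueMatch w.length θ₁ θ₂, by simpa using isMatch_glue m₁ m₂,
    preNorm_glue Γ _ w v θ₁ θ₂ rfl hw hv m₁⟩

theorem realizes_wrap {Γ : Scale X} {m : List (Letter X)} {r : ℝ≥0} (hm : m ≠ [])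
    (a y : Letter X) (h : Realizes Γ m r) :
    Realizes Γ (a :: (m ++ [y])) (nndist a⁻¹ y + min (Γ a⁻¹ r) (Γ y r)) := by
  obtain ⟨θ, hθ, rfl⟩ := h
  set n := m.length with hn
  let μ : ℕ → ℕ := fun i => if i = 0 then n + 1 else if i = n + 1 then 0 else θ (i - 1) + 1
  have hμ0 : μ 0 = n + 1 := rfl
  have hμl : μ (n + 1) = 0 := by simp [μ]
  have hμ : ∀ i, i ≠ 0 → i < n + 1 → μ i = θ (i - 1) + 1 := by
    intro i h1 h2
    simp only [μ]
    rw [if_neg h1, if_neg (by omega)]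
  refine ⟨μ, ⟨fun i hi => ?_, fun i hi => ?_, fun i hi j hj hij => ?_⟩, ?_⟩
  · simp only [List.length_cons, List.length_append, List.length_nil, ← hn] at hi ⊢
    rcases Nat.eq_zero_or_pos i with rfl | hpos
    · omega
    rcases Nat.lt_or_ge i (n + 1) with hlt | hge
    · rw [hμ i (by omega) hlt]
      have := hθ.lt (i - 1) (by omega)
      omega
    · rw [show i = n + 1 by omega]; omega
  · simp only [List.length_cons, List.length_append, List.length_nil, ← hn] at hi ⊢
    rcases Nat.eq_zero_or_pos i with rfl | hpos
    · rw [hμ0, hμl]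
    rcases Nat.lt_or_ge i (n + 1) with hlt | hge
    · have := hθ.lt (i - 1) (by omega)
      rw [hμ i (by omega) hlt, hμ _ (by omega) (by omega), Nat.add_sub_cancel,
        hθ.invol _ (by omega)]
      omega
    · rw [show i = n + 1 by omega, hμl, hμ0]
  · simp only [List.length_cons, List.length_append, List.length_nil, ← hn] at hi hj
    obtain ⟨hij, h2, h3⟩ := hij
    have hj1 : j < n + 1 := by
      by_contra hc
      rw [show j = n + 1 by omega, hμl] at h3
      omega
    rw [hμ j (by omega) hj1] at h3
    have hjl := hθ.lt (j - 1) (by omega)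
    rcases Nat.eq_zero_or_pos i with rfl | hpos
    · omega
    rw [hμ i (by omega) (by omega)] at h2 h3
    exact hθ.noncrossing (i - 1) (by omega) (j - 1) (by omega) ⟨by omega, by omega, by omega⟩
  · have e : preNorm Γ m (fun i => μ (i + 1) - 1) = preNorm Γ m θ := by
      refine preNorm_congr Γ _ _ _ _ rfl (fun i hi => ?_)
      rw [hμ _ (by omega) (by omega)]
      simp
    rw [preNorm_wrap Γ a y m hm μ (by omega), e]

/-- The formal inverse of a word. -/
def invWord (w : List (Letter X)) : List (Letter X) :=
  (w.map (fun a => a⁻¹)).reverse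

theorem invWord_append (w v : List (Letter X)) : invWord (w ++ v) = invWord v ++ invWord w := by
  simp [invWord]

theorem invWord_ne_nil {w : List (Letter X)} (hw : w ≠ []) : invWord w ≠ [] := by
  simpa [invWord] using hw

theorem evalWord_append (w v : List (Letter X)) :
    evalWord (w ++ v) = evalWord w * evalWord v := by
  simp [evalWord]

theorem evalWord_cons (a : Letter X) (v : List (Letter X)) :
    evalWord (a :: v) = a.toFree * evalWord v := by
  simp [evalWord]

theorem evalWord_invWord (w : List (Letter X)) : evalWord (invWord w) = (evalWord w)⁻¹ := by
  induction w with
  | nil => simp [invWord, evalWord]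
  | cons a t ih =>
    have : a :: t = [a] ++ t := rfl
    rw [this, invWord_append, evalWord_append, ih, evalWord_append, mul_inv_rev]
    congr 1
    simp [invWord, evalWord, Letter.toFree_inv]

theorem evalWord_surjective (g : FreeGroup X) : ∃ w : List (Letter X), w ≠ [] ∧ evalWord w = g := by
  induction g using FreeGroup.induction_on with
  | C1 => exact ⟨[Letter.e], by simp, by simp [evalWord, Letter.toFree]⟩
  | of x => exact ⟨[Letter.pos x], by simp, by simp [evalWord, Letter.toFree]⟩
  | inv_of x _ => exact ⟨[Letter.neg x], by simp, by simp [evalWord, Letter.toFree]⟩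
  | mul g h hg hh =>
    obtain ⟨w, hw, rfl⟩ := hg
    obtain ⟨v, _, rfl⟩ := hh
    exact ⟨w ++ v, by simp [hw], evalWord_append w v⟩

theorem wordNorm_le {Γ : Scale X} {w : List (Letter X)} {r : ℝ≥0} (hw : w ≠ [])
    (h : Realizes Γ w r) : wordNorm Γ (evalWord w) ≤ r := by
  obtain ⟨θ, hθ, e⟩ := h
  exact csInf_le' ⟨w, θ, hw, rfl, hθ, e⟩

theorem exists_realizes_lt {Γ : Scale X} {g : FreeGroup X} {ε : ℝ≥0} (h : wordNorm Γ g < ε) :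
    ∃ w r, w ≠ [] ∧ evalWord w = g ∧ Realizes Γ w r ∧ r < ε := by
  have hne : {r | ∃ w : List (Letter X), ∃ θ : ℕ → ℕ,
      w ≠ [] ∧ evalWord w = g ∧ IsMatch w.length θ ∧ preNorm Γ w θ = r}.Nonempty := by
    obtain ⟨w, hw, rfl⟩ := evalWord_surjective g
    exact ⟨_, w, id, hw, rfl, ⟨fun _ h => h, fun _ _ => rfl,
      fun i _ j _ h => by simp only [id] at h; omega⟩, rfl⟩
  obtain ⟨r, ⟨w, θ, hw, e, hθ, hr⟩, hlt⟩ := exists_lt_of_csInf_lt hne h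
  exact ⟨w, r, hw, e, ⟨θ, hθ, hr⟩, hlt⟩

theorem wordNorm_one (Γ : Scale X) : wordNorm Γ 1 = 0 := by
  have h := wordNorm_le (Γ := Γ) (by simp) (realizes_single Γ Letter.e)
  have e : evalWord [(Letter.e : Letter X)] = 1 := by simp [evalWord, Letter.toFree]
  rw [e, nndist_self] at h
  exact le_antisymm h zero_le

theorem wordNorm_mul_le (Γ : Scale X) (g h : FreeGroup X) :
    wordNorm Γ (g * h) ≤ wordNorm Γ g + wordNorm Γ h := by
  refine le_of_forall_pos_le_add fun ε hε => ?_
  obtain ⟨w, r, hw, rfl, hr, hlt⟩ :=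
    exists_realizes_lt (Γ := Γ) (g := g) (lt_add_of_pos_right _ (half_pos hε))
  obtain ⟨v, s, hv, rfl, hs, hlt'⟩ :=
    exists_realizes_lt (Γ := Γ) (g := h) (lt_add_of_pos_right _ (half_pos hε))
  rw [← evalWord_append]
  calc wordNorm Γ (evalWord (w ++ v)) ≤ r + s :=
        wordNorm_le (by simp [hw]) (realizes_append hw hv hr hs)
    _ ≤ (wordNorm Γ (evalWord w) + ε / 2) + (wordNorm Γ (evalWord v) + ε / 2) :=
        add_le_add hlt.le hlt'.le
    _ = wordNorm Γ (evalWord w) + wordNorm Γ (evalWord v) + ε := by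
        rw [add_add_add_comm, add_halves]

theorem wordNorm_letter_conj (Γ : Scale X) (a : Letter X) (g : FreeGroup X) {ε : ℝ≥0}
    (h : wordNorm Γ g < ε) : wordNorm Γ (a.toFree⁻¹ * g * a.toFree) ≤ Γ a ε := by
  obtain ⟨w, r, hw, rfl, hr, hlt⟩ := exists_realizes_lt h
  have h1 := wordNorm_le (by simp) (realizes_wrap hw a⁻¹ a hr)
  rw [evalWord_cons, evalWord_append, Letter.toFree_inv, Letter.inv_inv', nndist_self, zero_add,
    min_self, ← mul_assoc] at h1
  have e : evalWord [a] = a.toFree := by simp [evalWord]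
  rw [e] at h1
  exact h1.trans (Γ.mono a hlt.le)

theorem wordNorm_conj (Γ : Scale X) (g : FreeGroup X) : ∀ ε > 0, ∃ η > 0, ∀ h,
    wordNorm Γ h < η → wordNorm Γ (g⁻¹ * h * g) < ε := by
  have letter : ∀ a : Letter X, ∀ ε > 0, ∃ η > 0, ∀ h,
      wordNorm Γ h < η → wordNorm Γ (a.toFree⁻¹ * h * a.toFree) < ε := by
    intro a ε hε
    have h1 := (Γ.tendsto_zero a).eventually (gt_mem_nhds hε)
    obtain ⟨δ, hδ, hball⟩ := Metric.eventually_nhds_iff.1 h1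
    refine ⟨Real.toNNReal (δ / 2), Real.toNNReal_pos.2 (half_pos hδ), fun h hh => ?_⟩
    refine (wordNorm_letter_conj Γ a h hh).trans_lt (hball ?_)
    rw [NNReal.dist_eq, Real.coe_toNNReal _ (half_pos hδ).le, NNReal.coe_zero, sub_zero,
      abs_of_pos (half_pos hδ)]
    exact half_lt_self hδ
  induction g using FreeGroup.induction_on with
  | C1 => exact fun ε hε => ⟨ε, hε, fun h hh => by simpa using hh⟩
  | of x => exact letter (Letter.pos x)
  | inv_of x _ => exact letter (Letter.neg x)
  | mul g k hg hk =>
    intro ε hε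
    obtain ⟨η, hη, h1⟩ := hk ε hε
    obtain ⟨ζ, hζ, h2⟩ := hg η hη
    refine ⟨ζ, hζ, fun h hh => ?_⟩
    have := h1 _ (h2 h hh)
    convert this using 2
    group

variable [InvIsometric X]

theorem realizes_inv (Γ : Scale X) (n : ℕ) : ∀ (w : List (Letter X)) (θ : ℕ → ℕ),
    w.length = n → w ≠ [] → IsMatch n θ → Realizes Γ (invWord w) (preNorm Γ w θ) := by
  induction n using Nat.strong_induction_on with
  | _ n ih =>
    intro w θ hn hw hθ
    rcases word_cases w hw with ⟨x, rfl⟩ | ⟨a, m, y, rfl⟩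
    · have h := realizes_single Γ x⁻¹
      have e : (Letter.e : Letter X) = Letter.e⁻¹ := rfl
      rw [e, InvIsometric.nndist_inv] at h
      simpa [invWord, preNorm] using h
    have hl : m.length + 2 = n := by simpa using hn
    by_cases hs : θ 0 + 1 < n
    · rw [preNorm_split Γ _ θ (by omega)]
      generalize (a :: (m ++ [y])) = w at *
      conv => arg 2; rw [← List.take_append_drop (θ 0 + 1) w]
      rw [invWord_append, add_comm (preNorm Γ _ _)]
      have ht : w.take (θ 0 + 1) ≠ [] := by
        rw [← List.length_pos_iff]; simp; omega
      have hd : w.drop (θ 0 + 1) ≠ [] := by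
        rw [← List.length_pos_iff]; simp; omega
      refine realizes_append (invWord_ne_nil hd) (invWord_ne_nil ht) ?_ ?_
      · exact ih (n - (θ 0 + 1)) (by omega) _ _ (by simp; omega) hd (isMatch_drop hθ hs)
      · exact ih (θ 0 + 1) (by omega) _ _ (by simp; omega) ht (isMatch_take hθ hs)
    · have h0 := hθ.lt 0 (by omega)
      have e : invWord (a :: (m ++ [y])) = y⁻¹ :: (invWord m ++ [a⁻¹]) := by
        simp [invWord]
      rw [e]
      by_cases hm : m = []
      · subst hm
        have h := realizes_pair Γ y⁻¹ a⁻¹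
        rw [Letter.inv_inv', nndist_comm] at h
        simp at hl
        simpa [invWord, preNorm_pair Γ a y θ (by omega)] using h
      · have hlt : m.length < θ 0 := by omega
        rw [preNorm_wrap Γ a y m hm θ hlt]
        have hi := isMatch_inner (n := m.length) (by rw [hl]; exact hθ) hlt
        have h := realizes_wrap (invWord_ne_nil hm) y⁻¹ a⁻¹ (ih _ (by omega) m _ rfl hm hi)
        rw [Letter.inv_inv', nndist_comm, min_comm] at h
        exact h

theorem wordNorm_inv (Γ : Scale X) (g : FreeGroup X) : wordNorm Γ g⁻¹ = wordNorm Γ g := by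
  have key : ∀ g : FreeGroup X, wordNorm Γ g⁻¹ ≤ wordNorm Γ g := by
    intro g
    refine le_of_forall_gt fun ε hε => ?_
    obtain ⟨w, r, hw, rfl, ⟨θ, hθ, rfl⟩, hlt⟩ := exists_realizes_lt hε
    rw [← evalWord_invWord]
    exact (wordNorm_le (invWord_ne_nil hw) (realizes_inv Γ _ w θ rfl hw hθ)).trans_lt hlt
  refine le_antisymm (key g) ?_
  conv_lhs => rw [← inv_inv g]
  exact key g⁻¹

end Norm

section Group

variable {X : Type*}

/-- The free group on `X`, carrying the metric `Δ_Γ` attached to the scale `Γ`. -/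
def ScaledFreeGroup (_Γ : Scale X) : Type _ := FreeGroup X

instance (Γ : Scale X) : Group (ScaledFreeGroup Γ) := inferInstanceAs (Group (FreeGroup X))

variable [MetricSpace (Letter X)]

/-- `δ_Γ(g, h) = N_Γ(g⁻¹ h)`. -/
def scaleDelta (Γ : Scale X) (g h : FreeGroup X) : ℝ≥0 := wordNorm Γ (g⁻¹ * h)

/-- `Δ_Γ(g, h) = max (δ_Γ(g, h)) (δ_Γ(g⁻¹, h⁻¹))`. -/
def bigDelta (Γ : Scale X) (g h : FreeGroup X) : ℝ≥0 :=
  max (scaleDelta Γ g h) (scaleDelta Γ g⁻¹ h⁻¹)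

theorem scaleDelta_self (Γ : Scale X) (g : FreeGroup X) : scaleDelta Γ g g = 0 := by
  simp [scaleDelta, wordNorm_one]

theorem scaleDelta_comm [InvIsometric X] (Γ : Scale X) (g h : FreeGroup X) :
    scaleDelta Γ g h = scaleDelta Γ h g := by
  unfold scaleDelta
  rw [← wordNorm_inv]
  congr 1
  group

theorem scaleDelta_triangle (Γ : Scale X) (g h k : FreeGroup X) :
    scaleDelta Γ g k ≤ scaleDelta Γ g h + scaleDelta Γ h k := by
  unfold scaleDelta
  have := wordNorm_mul_le Γ (g⁻¹ * h) (h⁻¹ * k)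
  rwa [show g⁻¹ * h * (h⁻¹ * k) = g⁻¹ * k by group] at this

variable [InvIsometric X]

/-- The identity map, from the metrized free group to the bare one. -/
def ScaledFreeGroup.val (Γ : Scale X) : ScaledFreeGroup Γ →* FreeGroup X :=
  MonoidHom.id (FreeGroup X)

open ScaledFreeGroup (val)

instance (Γ : Scale X) : PseudoMetricSpace (ScaledFreeGroup Γ) where
  dist g h := (bigDelta Γ (val Γ g) (val Γ h) : ℝ)
  dist_self g := by simp only [bigDelta, scaleDelta_self, max_self, NNReal.coe_zero]
  dist_comm g h := by
    simp only [bigDelta]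
    rw [scaleDelta_comm Γ (val Γ g), scaleDelta_comm Γ (val Γ g)⁻¹]
  dist_triangle g h k := by
    rw [← NNReal.coe_add, NNReal.coe_le_coe]
    exact max_le
      ((scaleDelta_triangle Γ _ (val Γ h) _).trans
        (add_le_add (le_max_left _ _) (le_max_left _ _)))
      ((scaleDelta_triangle Γ _ (val Γ h)⁻¹ _).trans
        (add_le_add (le_max_right _ _) (le_max_right _ _)))

theorem dist_scaledFreeGroup (Γ : Scale X) (g h : ScaledFreeGroup Γ) :
    dist g h = (bigDelta Γ (val Γ g) (val Γ h) : ℝ) := rfl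

theorem dist_lt_iff (Γ : Scale X) (g h : ScaledFreeGroup Γ) (ε : ℝ≥0) :
    dist g h < ε ↔ scaleDelta Γ (val Γ g) (val Γ h) < ε ∧
      scaleDelta Γ (val Γ g)⁻¹ (val Γ h)⁻¹ < ε := by
  rw [dist_scaledFreeGroup, NNReal.coe_lt_coe, bigDelta, max_lt_iff]

theorem dist_inv_inv_scaled (Γ : Scale X) (g h : ScaledFreeGroup Γ) :
    dist g⁻¹ h⁻¹ = dist g h := by
  rw [dist_scaledFreeGroup, dist_scaledFreeGroup, map_inv, map_inv, bigDelta, bigDelta, inv_inv,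
    inv_inv, max_comm]

theorem uniformContinuous_inv_scaled (Γ : Scale X) :
    UniformContinuous (fun g : ScaledFreeGroup Γ => g⁻¹) :=
  (Isometry.of_dist_eq (dist_inv_inv_scaled Γ)).uniformContinuous

theorem scaleDelta_mul_mul_lt (Γ : Scale X) {ε : ℝ≥0} {c g g' h h' : FreeGroup X}
    (h2 : scaleDelta Γ c h < ε / 3) (h3 : scaleDelta Γ c h' < ε / 3)
    (h1 : wordNorm Γ (c⁻¹ * (g⁻¹ * g') * c) < ε / 3) :
    scaleDelta Γ (g * h) (g' * h') < ε := by
  have e : (g * h)⁻¹ * (g' * h') =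
      (c⁻¹ * h)⁻¹ * (c⁻¹ * (g⁻¹ * g') * c) * (c⁻¹ * h') := by group
  unfold scaleDelta at *
  rw [e]
  rw [← wordNorm_inv] at h2
  calc _ ≤ wordNorm Γ (c⁻¹ * h)⁻¹ + wordNorm Γ (c⁻¹ * (g⁻¹ * g') * c)
        + wordNorm Γ (c⁻¹ * h') :=
        (wordNorm_mul_le Γ _ _).trans (add_le_add_left (wordNorm_mul_le Γ _ _) _)
    _ < ε / 3 + ε / 3 + ε / 3 := add_lt_add (add_lt_add h2 h1) h3
    _ = ε := add_thirds ε

/-- Multiplying by elements of a small set of a Cauchy filter distorts `δ_Γ` uniformly little. -/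
theorem cauchy_uniform_mul (Γ : Scale X) {H : Filter (ScaledFreeGroup Γ)} (hH : Cauchy H)
    {ε : ℝ≥0} (hε : 0 < ε) : ∃ η > (0 : ℝ≥0), ∃ s ∈ H,
      ∀ h ∈ s, ∀ h' ∈ s, ∀ g g' : FreeGroup X, scaleDelta Γ g g' < η →
        scaleDelta Γ (g * val Γ h) (g' * val Γ h') < ε ∧
          scaleDelta Γ (g * (val Γ h)⁻¹) (g' * (val Γ h')⁻¹) < ε := by
  have := hH.1
  obtain ⟨s, hs, hd⟩ := (Metric.cauchy_iff.1 hH).2 (ε / 3 : ℝ≥0) (by positivity)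
  obtain ⟨c, hcs⟩ := hH.1.nonempty_of_mem hs
  obtain ⟨η₁, hη₁, C₁⟩ := wordNorm_conj Γ (val Γ c) (ε / 3) (by positivity)
  obtain ⟨η₂, hη₂, C₂⟩ := wordNorm_conj Γ (val Γ c)⁻¹ (ε / 3) (by positivity)
  refine ⟨min η₁ η₂, lt_min hη₁ hη₂, s, hs, fun h hh h' hh' g g' hg => ?_⟩
  have a := (dist_lt_iff Γ c h _).1 (hd c hcs h hh)
  have b := (dist_lt_iff Γ c h' _).1 (hd c hcs h' hh')
  exact ⟨scaleDelta_mul_mul_lt Γ a.1 b.1 (C₁ _ (hg.trans_le (min_le_left _ _))),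
    scaleDelta_mul_mul_lt Γ a.2 b.2 (C₂ _ (hg.trans_le (min_le_right _ _)))⟩

/-- The product of two Cauchy filters is Cauchy. -/
theorem cauchy_mul (Γ : Scale X) {F G : Filter (ScaledFreeGroup Γ)} (hF : Cauchy F)
    (hG : Cauchy G) : Cauchy (map (fun p : ScaledFreeGroup Γ × ScaledFreeGroup Γ => p.1 * p.2)
      (F ×ˢ G)) := by
  have := hF.1
  have := hG.1
  refine Metric.cauchy_iff.2 ⟨inferInstance, fun ε hε => ?_⟩
  lift ε to ℝ≥0 using hε.le
  have hε' : 0 < ε := by exact_mod_cast hε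
  obtain ⟨η₁, hη₁, t₂, ht₂, P⟩ := cauchy_uniform_mul Γ hG hε'
  obtain ⟨η₂, hη₂, s₂, hs₂, Q⟩ := cauchy_uniform_mul Γ hF hε'
  obtain ⟨s₃, hs₃, R⟩ := (Metric.cauchy_iff.1 hF).2 η₁ (by exact_mod_cast hη₁)
  obtain ⟨t₃, ht₃, S⟩ := (Metric.cauchy_iff.1 hG).2 η₂ (by exact_mod_cast hη₂)
  refine ⟨(fun p : ScaledFreeGroup Γ × ScaledFreeGroup Γ => p.1 * p.2) ''
    ((s₂ ∩ s₃) ×ˢ (t₂ ∩ t₃)),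
    image_mem_map (prod_mem_prod (inter_mem hs₂ hs₃) (inter_mem ht₂ ht₃)), ?_⟩
  rintro _ ⟨⟨g, h⟩, ⟨⟨hg2, hg3⟩, hh2, hh3⟩, rfl⟩ _ ⟨⟨g', h'⟩, ⟨⟨hg2', hg3'⟩, hh2', hh3'⟩, rfl⟩
  have a := (dist_lt_iff Γ g g' _).1 (R g hg3 g' hg3')
  have b := (dist_lt_iff Γ h h' _).1 (S h hh3 h' hh3')
  refine (dist_lt_iff Γ _ _ ε).2 ⟨?_, ?_⟩
  · simpa only [map_mul] using (P h hh2 h' hh2' _ _ a.1).1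
  · simpa only [map_mul, mul_inv_rev] using (Q g hg2 g' hg2' _ _ b.2).2

/-- The completion of the free group on `X` with respect to `Δ_Γ`, with the group operations
extended by continuity. -/
def FBar (Γ : Scale X) : Type _ := UniformSpace.Completion (ScaledFreeGroup Γ)

namespace FBar

variable (Γ : Scale X)

instance : MetricSpace (FBar Γ) :=
  inferInstanceAs (MetricSpace (UniformSpace.Completion (ScaledFreeGroup Γ)))

instance : CompleteSpace (FBar Γ) :=
  inferInstanceAs (CompleteSpace (UniformSpace.Completion (ScaledFreeGroup Γ)))

/-- The embedding of the free group into its completion. -/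
def coe (g : ScaledFreeGroup Γ) : FBar Γ := UniformSpace.Completion.coe' g

theorem isDenseInducing_coe : IsDenseInducing (coe Γ) := UniformSpace.Completion.isDenseInducing_coe

theorem isUniformInducing_coe : IsUniformInducing (coe Γ) :=
  UniformSpace.Completion.isUniformInducing_coe _

/-- The limit of `g * h` exists as `g` and `h` tend to points of the completion. -/
theorem exists_tendsto_mul (b : FBar Γ × FBar Γ) : ∃ c, Tendsto
    (fun p : ScaledFreeGroup Γ × ScaledFreeGroup Γ => coe Γ (p.1 * p.2))
    (comap (Prod.map (coe Γ) (coe Γ)) (𝓝 b)) (𝓝 c) := by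
  have hc : ∀ x : FBar Γ, Cauchy (comap (coe Γ) (𝓝 x)) := fun x => by
    have := (isDenseInducing_coe Γ).comap_nhds_neBot x
    exact cauchy_nhds.comap (isUniformInducing_coe Γ).comap_uniformity.le
  have h := (cauchy_mul Γ (hc b.1) (hc b.2)).map
    (isUniformInducing_coe Γ).uniformContinuous
  obtain ⟨c, hcle⟩ := CompleteSpace.complete h
  refine ⟨c, ?_⟩
  rw [← Prod.mk.eta (p := b), nhds_prod_eq, comap_prodMap_prod]
  exact hcle

theorem isDenseInducing_prod : IsDenseInducing (Prod.map (coe Γ) (coe Γ)) :=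
  (isDenseInducing_coe Γ).prodMap (isDenseInducing_coe Γ)

instance : Mul (FBar Γ) where
  mul a b := (isDenseInducing_prod Γ).extend
    (fun p : ScaledFreeGroup Γ × ScaledFreeGroup Γ => coe Γ (p.1 * p.2)) (a, b)

instance : Inv (FBar Γ) where
  inv := UniformSpace.Completion.map (fun g : ScaledFreeGroup Γ => g⁻¹)

instance : One (FBar Γ) where
  one := coe Γ 1

theorem continuous_mul' : Continuous (fun p : FBar Γ × FBar Γ => p.1 * p.2) :=
  (isDenseInducing_prod Γ).continuous_extend (exists_tendsto_mul Γ)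

theorem coe_mul (g h : ScaledFreeGroup Γ) : coe Γ (g * h) = coe Γ g * coe Γ h :=
  ((isDenseInducing_prod Γ).extend_eq' (exists_tendsto_mul Γ) (g, h)).symm

theorem continuous_inv' : Continuous (fun a : FBar Γ => a⁻¹) :=
  UniformSpace.Completion.continuous_map

theorem coe_inv (g : ScaledFreeGroup Γ) : coe Γ g⁻¹ = (coe Γ g)⁻¹ :=
  (UniformSpace.Completion.map_coe (uniformContinuous_inv_scaled Γ) g).symm

instance : Group (FBar Γ) :=
  Group.ofLeftAxioms
    (fun a b c => by
      have hm := continuous_mul' Γ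
      have h1 : Continuous fun p : FBar Γ × FBar Γ × FBar Γ => p.1 * p.2.1 * p.2.2 :=
        hm.comp ((hm.comp (continuous_fst.prodMk (continuous_fst.comp continuous_snd))).prodMk
          (continuous_snd.comp continuous_snd))
      have h2 : Continuous fun p : FBar Γ × FBar Γ × FBar Γ => p.1 * (p.2.1 * p.2.2) :=
        hm.comp (continuous_fst.prodMk (hm.comp continuous_snd))
      exact isClosed_property3 (isDenseInducing_coe Γ).dense
        (p := fun a b c => a * b * c = a * (b * c)) (isClosed_eq h1 h2)
        (fun x y z => by rw [← coe_mul, ← coe_mul, ← coe_mul, ← coe_mul, mul_assoc]) a b c)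
    (fun a => by
      have hm := continuous_mul' Γ
      exact isClosed_property (isDenseInducing_coe Γ).dense (p := fun a => 1 * a = a)
        (isClosed_eq (hm.comp (continuous_const.prodMk continuous_id)) continuous_id)
        (fun x => by rw [show (1 : FBar Γ) = coe Γ 1 from rfl, ← coe_mul, one_mul]) a)
    (fun a => by
      have hm := continuous_mul' Γ
      exact isClosed_property (isDenseInducing_coe Γ).dense (p := fun a => a⁻¹ * a = 1)
        (isClosed_eq (hm.comp ((continuous_inv' Γ).prodMk continuous_id)) continuous_const)
        (fun x => by rw [← coe_inv, ← coe_mul, inv_mul_cancel]; rfl) a)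

instance : IsTopologicalGroup (FBar Γ) where
  continuous_mul := continuous_mul' Γ
  continuous_inv := continuous_inv' Γ

/-- The canonical homomorphism from the free group to its completion. -/
def ofFree : FreeGroup X →* FBar Γ where
  toFun g := coe Γ g
  map_one' := rfl
  map_mul' g h := coe_mul Γ g h

end FBar

end Group

section Properties

variable {X : Type*} [MetricSpace (Letter X)]

/-- Condition (A1) together with condition (A2). -/
structure IsAdequate (Γ : Scale X) : Prop where
  a1 : ∀ (x y z : Letter X) (r₁ r₂ : ℝ≥0),
    min (Γ x (r₁ + r₂)) (Γ y (r₁ + r₂)) + nndist x y ≤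
      min (Γ x r₁) (Γ z r₁) + nndist x z + min (Γ y r₂) (Γ z r₂) + nndist y z
  a2 : ∀ (x y z : Letter X) (r₁ r₂ r : ℝ≥0),
    r = r₁ + min (Γ y⁻¹ r₂) (Γ z⁻¹ r₂) + nndist y z →
    min (Γ x r₁) (Γ y r₁) + nndist x y + r₂ ≤ min (Γ x r) (Γ z r) + nndist x z

/-- Good scales, over a space of letters with an ultrametric distance. -/
structure IsGood [IsUltrametricDist (Letter X)] (Γ : Scale X) : Prop where
  g1 : ∀ (x y : Letter X) (r : ℝ≥0), Γ x r ≤ Γ y r + nndist x y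
  g2 : ∀ x : Letter X, AntitoneOn (fun r => Γ x r / r) (Set.Ioi 0)
  g3 : ∀ (x : Letter X) (r₁ r₂ : ℝ≥0), Γ x r₁ + r₂ ≤ Γ x (r₁ + r₂)

end Properties

/-- A surjectively universal Polish group: a Polish group that maps onto every Polish group by a
continuous homomorphism. -/
structure IsSurjectivelyUniversal (G : Type*) [Group G] [TopologicalSpace G] : Prop where
  isTopologicalGroup : IsTopologicalGroup G
  polishSpace : PolishSpace G
  exists_surjective : ∀ (H : Type u) [Group H] [TopologicalSpace H] [IsTopologicalGroup H]
    [PolishSpace H], ∃ Φ : G →* H, Continuous Φ ∧ Function.Surjective Φ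

/-- `𝚷⁰₃` sets: countable intersections of countable unions of closed sets. -/
def IsPi03 {α : Type*} [TopologicalSpace α] (A : Set α) : Prop :=
  ∃ C : ℕ → ℕ → Set α, (∀ i j, IsClosed (C i j)) ∧ A = ⋂ i, ⋃ j, C i j

/-- The group `S_∞` of permutations of `ℕ` carries the topology of pointwise convergence. -/
instance permNatTopology : TopologicalSpace (Equiv.Perm ℕ) :=
  TopologicalSpace.induced (fun σ : Equiv.Perm ℕ => (σ : ℕ → ℕ)) inferInstance

/-! ### The Baire space and its finite levels -/

/-- The Baire space `𝒩`. -/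
abbrev Baire : Type := ℕ → ℕ

namespace Baire

open Classical in
/-- `baireDist x y = 2 ^ (-n)` for the first `n` with `x n ≠ y n`. -/
def baireDist (x y : Baire) : ℝ :=
  if x = y then 0 else (1 / 2 : ℝ) ^ PiNat.firstDiff x y

/-- The distance on `𝒩 ∪ 𝒩⁻¹ ∪ {e}`: letters of different kinds have distance `1`. -/
def letterDist : Letter Baire → Letter Baire → ℝ
  | Letter.e, Letter.e => 0
  | Letter.pos x, Letter.pos y => baireDist x y
  | Letter.neg x, Letter.neg y => baireDist x y
  | _, _ => 1

theorem baireDist_eq (x y : Baire) :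
    baireDist x y = @dist Baire PiNat.dist x y := by
  unfold baireDist
  split_ifs with h
  · rw [h, PiNat.dist_self]
  · rw [PiNat.dist_eq_of_ne h]

theorem baireDist_nonneg (x y : Baire) : 0 ≤ baireDist x y := by
  rw [baireDist_eq]; exact PiNat.dist_nonneg x y

theorem baireDist_le_one (x y : Baire) : baireDist x y ≤ 1 := by
  rw [baireDist_eq]; exact PiNat.dist_le_one x y

theorem baireDist_comm (x y : Baire) : baireDist x y = baireDist y x := by
  rw [baireDist_eq, baireDist_eq]; exact PiNat.dist_comm x y

theorem baireDist_self (x : Baire) : baireDist x x = 0 := by simp [baireDist]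

theorem baireDist_triangle (x y z : Baire) :
    baireDist x z ≤ max (baireDist x y) (baireDist y z) := by
  simp only [baireDist_eq]; exact PiNat.dist_triangle_nonarch x y z

theorem eq_of_baireDist_eq_zero (x y : Baire) (h : baireDist x y = 0) : x = y := by
  rw [baireDist_eq] at h; exact PiNat.eq_of_dist_eq_zero x y h

theorem letterDist_nonneg (a b : Letter Baire) : 0 ≤ letterDist a b := by
  cases a <;> cases b <;> simp [letterDist, baireDist_nonneg]

theorem letterDist_triangle (a b c : Letter Baire) :
    letterDist a c ≤ max (letterDist a b) (letterDist b c) := by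
  cases a <;> cases b <;> cases c <;>
    first
    | exact baireDist_triangle _ _ _
    | simp [letterDist, baireDist_le_one, baireDist_nonneg]

instance : MetricSpace (Letter Baire) where
  dist := letterDist
  dist_self a := by cases a <;> simp [letterDist, baireDist_self]
  dist_comm a b := by cases a <;> cases b <;> simp [letterDist, baireDist_comm]
  dist_triangle a b c := (letterDist_triangle a b c).trans
    (max_le_add_of_nonneg (letterDist_nonneg a b) (letterDist_nonneg b c))
  eq_of_dist_eq_zero {a b} h := by
    change letterDist a b = 0 at h
    cases a <;> cases b <;> simp_all [letterDist] <;> exact eq_of_baireDist_eq_zero _ _ h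

instance : IsUltrametricDist (Letter Baire) := ⟨letterDist_triangle⟩

instance : InvIsometric Baire where
  nndist_inv a b := by
    apply NNReal.coe_injective
    rw [coe_nndist, coe_nndist]
    cases a <;> cases b <;> rfl

/-- Letters over a subset of the Baire space carry the restricted distance. -/
instance (S : Set Baire) : MetricSpace (Letter S) :=
  MetricSpace.induced (Letter.map Subtype.val) (Letter.map_injective Subtype.val_injective)
    inferInstance

instance (S : Set Baire) : IsUltrametricDist (Letter S) :=
  ⟨fun a b c => letterDist_triangle (a.map Subtype.val) (b.map Subtype.val) (c.map Subtype.val)⟩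

instance (S : Set Baire) : InvIsometric S where
  nndist_inv a b := by
    apply NNReal.coe_injective
    rw [coe_nndist, coe_nndist]
    cases a <;> cases b <;> rfl

/-- `𝒩_n`: the sequences that vanish from index `n` on. -/
def level (n : ℕ) : Set Baire := {x | ∀ m, n ≤ m → x m = 0}

/-- `𝒩_ω`: the sequences that are eventually `0`. -/
def levelOmega : Set Baire := ⋃ n, level n

/-- The truncation `π_n`. -/
def trunc (n : ℕ) (x : Baire) : Baire := fun m => if m < n then x m else 0

theorem trunc_mem_level (n : ℕ) (x : Baire) : trunc n x ∈ level n := by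
  intro m hm
  simp [trunc, hm]

/-- `π_n` as a map into `𝒩_n`. -/
def truncLevel (n : ℕ) (x : Baire) : level n := ⟨trunc n x, trunc_mem_level n x⟩

/-- `π_n` as a map into `𝒩_ω`. -/
def truncOmega (n : ℕ) (x : Baire) : levelOmega :=
  ⟨trunc n x, Set.mem_iUnion.2 ⟨n, trunc_mem_level n x⟩⟩

open Classical in
/-- The value `Γ₀(x, r)` for `x ∈ 𝒩_m`, by recursion on `m`. -/
def gammaLevel : ℕ → Baire → ℝ≥0 → ℝ≥0
  | 0, _, r => r
  | m + 1, x, r =>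
    if x ∈ level m then gammaLevel m x r
    else min
      (2 ^ 5 * (1 + ∑ j ∈ Finset.range (m + 1), 2 ^ (∑ i ∈ Finset.range (j + 1), x i)) * r)
      (gammaLevel m (trunc m x) r + (1 / 2) ^ (m + 1))

theorem le_gammaLevel (m : ℕ) (x : Baire) (r : ℝ≥0) : r ≤ gammaLevel m x r := by
  induction m generalizing x with
  | zero => exact le_rfl
  | succ m ih =>
    rw [gammaLevel]
    split_ifs
    · exact ih x
    · refine le_min (le_mul_of_one_le_left zero_le ?_) ((ih _).trans le_self_add)
      refine one_le_mul (by norm_num) ?_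
      exact le_self_add

theorem gammaLevel_le (m : ℕ) (x : Baire) : ∃ c : ℝ≥0, ∀ r, gammaLevel m x r ≤ c * r := by
  induction m generalizing x with
  | zero => exact ⟨1, fun r => by simp [gammaLevel]⟩
  | succ m ih =>
    by_cases h : x ∈ level m
    · obtain ⟨c, hc⟩ := ih x
      exact ⟨c, fun r => by rw [gammaLevel, if_pos h]; exact hc r⟩
    · exact ⟨_, fun r => by rw [gammaLevel, if_neg h]; exact min_le_left _ _⟩

theorem gammaLevel_mono (m : ℕ) (x : Baire) : Monotone (gammaLevel m x) := by
  induction m generalizing x with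
  | zero => exact fun _ _ h => h
  | succ m ih =>
    intro r s hrs
    rw [gammaLevel, gammaLevel]
    split_ifs
    · exact ih x hrs
    · exact min_le_min (mul_le_mul_right hrs _) (add_le_add_left (ih _ hrs) _)

/-- The least `m` with `x ∈ 𝒩_m`. -/
def rank (x : levelOmega) : ℕ := sInf {m | (x : Baire) ∈ level m}

/-- The scale `Γ₀` on `𝒩_ω ∪ 𝒩_ω⁻¹ ∪ {e}`. -/
def gammaZero : Scale levelOmega where
  toFun a r := match a with
    | Letter.e => r
    | Letter.pos x => gammaLevel (rank x) x r
    | Letter.neg x => gammaLevel (rank x) x r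
  map_e _ := rfl
  le_map a r := by
    cases a
    · exact le_rfl
    all_goals exact le_gammaLevel _ _ _
  eq_zero_iff a r := by
    have key : ∀ m x, gammaLevel m x r = 0 ↔ r = 0 := fun m x => by
      refine ⟨fun h => le_antisymm (h ▸ le_gammaLevel m x r) zero_le, fun h => ?_⟩
      obtain ⟨c, hc⟩ := gammaLevel_le m x
      exact le_antisymm ((hc r).trans (by simp [h])) zero_le
    cases a
    · exact Iff.rfl
    all_goals exact key _ _
  mono a := by
    cases a
    · exact fun _ _ h => h
    all_goals exact gammaLevel_mono _ _
  tendsto_zero a := by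
    have key : ∀ m x, Tendsto (gammaLevel m x) (𝓝 0) (𝓝 0) := fun m x => by
      obtain ⟨c, hc⟩ := gammaLevel_le m x
      have h : Tendsto (fun r : ℝ≥0 => c * r) (𝓝 0) (𝓝 0) := by
        have := (continuous_const_mul c).tendsto (0 : ℝ≥0)
        rwa [mul_zero] at this
      exact tendsto_of_tendsto_of_tendsto_of_le_of_le tendsto_const_nhds h
        (fun _ => zero_le) hc
    cases a
    · exact tendsto_id
    all_goals exact key _ _

/-- Condition (S1) with the constant `K`. -/
def CondS1 (Γ : Scale levelOmega) (K : ℕ) : Prop :=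
  ∀ m > 0, ∀ x : levelOmega, (x : Baire) ∈ level m \ level (m - 1) →
    ∀ r > (1 / 2 : ℝ≥0) ^ (m + K + 5), ∃ y : levelOmega, (y : Baire) ∈ level (m - 1) ∧
      min ((1 / 2) ^ (K + 3))
        (Γ (Letter.pos y) r + (1 / 2) ^ K * nndist (Letter.pos x) (Letter.pos y)) ≤
      Γ (Letter.pos x) r

/-- The set `E_m^k` attached to the constant `K`. -/
def exceptionalSet (Γ : Scale levelOmega) (K k m : ℕ) : Set levelOmega :=
  {x | (x : Baire) ∈ level m \ level (m - 1) ∧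
    ∃ r ∈ Set.Ioc ((1 / 2 : ℝ≥0) ^ k) ((1 / 2) ^ (m + K + 5)),
      ∀ y : levelOmega, (y : Baire) ∈ level (m - 1) →
        Γ (Letter.pos x) r < min ((1 / 2) ^ (K + 3))
          (Γ (Letter.pos y) r + (1 / 2) ^ K * nndist (Letter.pos x) (Letter.pos y))}

/-- Condition (S2) with the constant `K`. -/
def CondS2 (Γ : Scale levelOmega) (K : ℕ) : Prop :=
  ∀ m > 0, ∀ k > m + K + 5, (exceptionalSet Γ K k m).Finite

/-- Condition (S3) with the constant `K`. -/
def CondS3 (Γ : Scale levelOmega) (K : ℕ) : Prop :=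
  ∀ m > 0, ∀ x : levelOmega, (x : Baire) ∈ level m \ level (m - 1) →
    ∀ r ≤ (1 / 2 : ℝ≥0) ^ (m + K + 5), 8 * r ≤ Γ (Letter.pos x) r

/-- Regular scales on the letters over the Baire space. -/
def IsRegular (Γ : Scale Baire) : Prop :=
  ∀ (x : Letter Baire) (r : ℝ≥0) (n : ℕ), Γ (x.map (trunc n)) r ≤ Γ x r

/-- The free groups on the levels are discrete. -/
instance (n : ℕ) : TopologicalSpace (FreeGroup (level n)) := ⊥

/-- The inverse limit of the groups `F(𝒩_n)` under the homomorphisms `F(𝒩_{n+1}) → F(𝒩_n)`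
induced by `π_n`, with the topology inherited from the product. -/
def invLimit : Subgroup (∀ n, FreeGroup (level n)) where
  carrier := {g | ∀ n, FreeGroup.map (fun x : level (n + 1) => truncLevel n x) (g (n + 1)) = g n}
  one_mem' := fun n => by simp
  mul_mem' := fun {g h} hg hh n => by
    rw [Pi.mul_apply, map_mul, hg n, hh n]; rfl
  inv_mem' := fun {g} hg n => by
    rw [Pi.inv_apply, map_inv, hg n]; rfl

end Baire

end

/-! Everything about Γ₀ itself rests on one feature of the recursion. Along the truncations of x the
values Γ₀(π_n(x), r) increase with n, and passing from n to n + 1 adds at most 2^{-(n+1)}; so from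
stage k on they stay within 2^{-k} of the value at stage k (`truncScale_mono`, `truncScale_le_add`).
Sequences that agree below k therefore have scales within 2^{-k} of each other, which gives (G1),
and the limits over the whole Baire space exist. (G2) and (G3) survive the addition of constants and
the minima in the recursion. Goodness implies adequacy over any ultrametric alphabet
(`IsGood.isAdequate`).

The norm is handled through its maximality (`le_wordNorm`): a subadditive function that respects the
distance and the scale on letters is at most N_Γ. It is applied twice.

Inverse limit. The function equal to 0 on the kernel of F(𝒩_ω) → F(𝒩_n) and to 2^{-n} off it is
admissible, so the projections are locally constant and extend to the completion. Truncation
increases neither distance nor scale, so the retractions of F(𝒩_ω) onto F(𝒩_n) are 1-Lipschitz, and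
they converge pointwise to the identity. A point of the completion is thus the limit of its
projections, which gives injectivity. The range consists of the coherent sequences whose lifts are
Cauchy, a 𝚷⁰₃ condition. The product of the countable discrete groups F(𝒩_n) is a closed subgroup of
S_∞ through left translations, which carries the range there.

Universality. Let g list a dense subset of a Polish group H so that every open set is visited at
arbitrarily large indices. A Birkhoff–Kakutani construction gives a length function on H for which
conjugation by g_i is Lipschitz with constant 2^5·2^i (`nonempty_conjLength`). A sequence x codes a
point of H: its partial sums are indices into g, and an entry is obeyed only if it is nonzero and
the element proposed is close to the current approximation. The two terms of the minimum that
defines Γ₀ are the two ways to bound conjugation by an approximation: directly by the Lipschitz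
constant, or by comparison with the preceding approximation (`len_conj_approx_le`). Hence the length
of the image of a word is at most its norm. The induced homomorphism extends because Polish groups
are complete for the two-sided uniformity, and it is onto because every point of H has a code. -/

noncomputable section

/-! ### The scale Γ₀ along truncations, and its goodness -/

namespace Baire

/-- The linear coefficient that the scale `Γ₀` attaches to a sequence of rank `n`. -/
def slope (n : ℕ) (x : Baire) : ℝ≥0 :=
  2 ^ 5 * (1 + ∑ j ∈ Finset.range n, 2 ^ (∑ i ∈ Finset.range (j + 1), x i))

/-- The value `Γ₀(π_n(x), r)`. -/
def truncScale (n : ℕ) (x : Baire) (r : ℝ≥0) : ℝ≥0 := gammaLevel n (trunc n x) r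

theorem trunc_trunc {m n : ℕ} (h : m ≤ n) (x : Baire) : trunc m (trunc n x) = trunc m x := by
  funext i
  simp only [trunc]
  split_ifs <;> first | rfl | omega

theorem trunc_eq_self {n : ℕ} {x : Baire} (h : x ∈ level n) : trunc n x = x := by
  funext i
  simp only [trunc]
  split_ifs with hi
  · rfl
  · exact (h i (not_lt.1 hi)).symm

theorem level_mono {m n : ℕ} (h : m ≤ n) : level m ⊆ level n :=
  fun _ hx i hi => hx i (h.trans hi)

theorem trunc_congr {n : ℕ} {x y : Baire} (h : ∀ i < n, x i = y i) : trunc n x = trunc n y := by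
  funext i
  simp only [trunc]
  split_ifs with hi
  · exact h i hi
  · rfl

theorem slope_congr {n : ℕ} {x y : Baire} (h : ∀ i < n, x i = y i) : slope n x = slope n y := by
  unfold slope
  congr 2
  refine Finset.sum_congr rfl fun j hj => ?_
  congr 1
  refine Finset.sum_congr rfl fun i hi => h i ?_
  rw [Finset.mem_range] at hi hj
  omega

theorem slope_mono (x : Baire) : Monotone fun n => slope n x := by
  refine monotone_nat_of_le_succ fun n => ?_
  unfold slope
  rw [Finset.sum_range_succ]
  gcongr
  exact le_self_add

theorem slope_succ (n : ℕ) (x : Baire) :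
    slope (n + 1) x = slope n x + 2 ^ 5 * 2 ^ (∑ i ∈ Finset.range (n + 1), x i) := by
  unfold slope
  rw [Finset.sum_range_succ]
  ring

theorem le_slope (n : ℕ) (x : Baire) : 2 ^ 5 ≤ slope n x :=
  le_mul_of_one_le_right zero_le le_self_add

theorem one_le_slope (n : ℕ) (x : Baire) : 1 ≤ slope n x :=
  (by norm_num : (1 : ℝ≥0) ≤ 2 ^ 5).trans (le_slope n x)

theorem truncScale_zero (x : Baire) (r : ℝ≥0) : truncScale 0 x r = r := rfl

theorem trunc_succ_mem_level {n : ℕ} {x : Baire} : trunc (n + 1) x ∈ level n ↔ x n = 0 := by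
  constructor
  · intro h
    simpa [trunc] using h n le_rfl
  · intro h i hi
    simp only [trunc]
    split_ifs with hin
    · rw [show i = n by omega, h]
    · rfl

theorem truncScale_succ_of_eq {n : ℕ} {x : Baire} (h : x n = 0) (r : ℝ≥0) :
    truncScale (n + 1) x r = truncScale n x r := by
  unfold truncScale
  have hm := trunc_succ_mem_level.2 h
  rw [gammaLevel, if_pos hm, ← trunc_eq_self hm, trunc_trunc n.le_succ]

theorem truncScale_succ_of_ne {n : ℕ} {x : Baire} (h : x n ≠ 0) (r : ℝ≥0) :
    truncScale (n + 1) x r =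
      min (slope (n + 1) x * r) (truncScale n x r + (1 / 2) ^ (n + 1)) := by
  unfold truncScale
  rw [gammaLevel, if_neg (fun hm => h (trunc_succ_mem_level.1 hm)), trunc_trunc n.le_succ]
  congr 2
  exact slope_congr (x := trunc (n + 1) x) fun i hi => by simp [trunc, hi]

theorem truncScale_congr {n : ℕ} {x y : Baire} (h : ∀ i < n, x i = y i) (r : ℝ≥0) :
    truncScale n x r = truncScale n y r := by
  unfold truncScale
  rw [trunc_congr h]

theorem truncScale_trunc {m n : ℕ} (h : m ≤ n) (x : Baire) (r : ℝ≥0) :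
    truncScale m (trunc n x) r = truncScale m x r := by
  unfold truncScale
  rw [trunc_trunc h]

/-- The coefficients increase with n, so a linear bound survives the stages at which the entry is 0.
It keeps the linear branch of the next minimum from falling below the value already reached. -/
theorem truncScale_le_slope (n : ℕ) (x : Baire) (r : ℝ≥0) : truncScale n x r ≤ slope n x * r := by
  induction n with
  | zero => exact le_mul_of_one_le_left zero_le (one_le_slope 0 x)
  | succ n ih =>
    by_cases h : x n = 0
    · rw [truncScale_succ_of_eq h]
      exact ih.trans (mul_le_mul_left (slope_mono x n.le_succ) r)
    · rw [truncScale_succ_of_ne h]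
      exact min_le_left _ _

theorem truncScale_le_succ (n : ℕ) (x : Baire) (r : ℝ≥0) :
    truncScale n x r ≤ truncScale (n + 1) x r := by
  by_cases h : x n = 0
  · rw [truncScale_succ_of_eq h]
  · rw [truncScale_succ_of_ne h]
    exact le_min ((truncScale_le_slope n x r).trans
      (mul_le_mul_left (slope_mono x n.le_succ) r)) le_self_add

theorem truncScale_mono (x : Baire) (r : ℝ≥0) : Monotone fun n => truncScale n x r :=
  monotone_nat_of_le_succ fun n => truncScale_le_succ n x r

theorem truncScale_succ_le (n : ℕ) (x : Baire) (r : ℝ≥0) :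
    truncScale (n + 1) x r ≤ truncScale n x r + (1 / 2) ^ (n + 1) := by
  by_cases h : x n = 0
  · rw [truncScale_succ_of_eq h]
    exact le_self_add
  · rw [truncScale_succ_of_ne h]
    exact min_le_right _ _

theorem half_pow_succ_add (n : ℕ) :
    (1 / 2 : ℝ≥0) ^ (n + 1) + (1 / 2) ^ (n + 1) = (1 / 2) ^ n := by
  rw [pow_succ, ← mul_add, add_halves, mul_one]

/-- One step adds at most 2^{-(n+1)} to the scale, which is exactly what the summand 2^{-n} loses.
-/
theorem truncScale_add_le {m n : ℕ} (h : m ≤ n) (x : Baire) (r : ℝ≥0) :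
    truncScale n x r + (1 / 2) ^ n ≤ truncScale m x r + (1 / 2) ^ m := by
  induction n, h using Nat.le_induction with
  | base => exact le_rfl
  | succ n _ ih =>
    refine le_trans ?_ ih
    calc truncScale (n + 1) x r + (1 / 2) ^ (n + 1)
        ≤ truncScale n x r + (1 / 2) ^ (n + 1) + (1 / 2) ^ (n + 1) :=
          add_le_add_left (truncScale_succ_le n x r) _
      _ = truncScale n x r + (1 / 2) ^ n := by rw [add_assoc, half_pow_succ_add]

theorem truncScale_le_add (m n : ℕ) (x : Baire) (r : ℝ≥0) :
    truncScale n x r ≤ truncScale m x r + (1 / 2) ^ m := by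
  rcases le_total m n with h | h
  · exact le_self_add.trans (truncScale_add_le h x r)
  · exact (truncScale_mono x r h).trans le_self_add

/-- Both scales pass through the same value at stage k; afterwards one gains at most 2^{-k} and the
other does not decrease. This is the core of (G1). -/
theorem truncScale_le_of_agree {k : ℕ} {x y : Baire} (h : ∀ i < k, x i = y i) (n : ℕ)
    (r : ℝ≥0) : truncScale n x r ≤ truncScale n y r + (1 / 2) ^ k := by
  rcases le_total k n with hk | hk
  · calc truncScale n x r ≤ truncScale k x r + (1 / 2) ^ k := truncScale_le_add k n x r
      _ = truncScale k y r + (1 / 2) ^ k := by rw [truncScale_congr h]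
      _ ≤ _ := add_le_add_left (truncScale_mono y r hk) _
  · rw [truncScale_congr (x := x) (y := y) fun i hi => h i (hi.trans_le hk)]
    exact le_self_add

theorem truncScale_add (n : ℕ) (x : Baire) (r s : ℝ≥0) :
    truncScale n x r + s ≤ truncScale n x (r + s) := by
  induction n with
  | zero => exact le_rfl
  | succ n ih =>
    by_cases h : x n = 0
    · simpa only [truncScale_succ_of_eq h] using ih
    · simp only [truncScale_succ_of_ne h]
      refine le_min ((add_le_add_left (min_le_left _ _) _).trans ?_)
        ((add_le_add_left (min_le_right _ _) _).trans ?_)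
      · rw [mul_add]
        gcongr
        exact le_mul_of_one_le_left zero_le (one_le_slope _ _)
      · rw [add_right_comm]
        gcongr

/-- This is (G2) cleared of denominators. It holds with equality for linear functions and is
preserved by adding a constant and by taking minima. -/
theorem truncScale_mul_le (n : ℕ) (x : Baire) {r s : ℝ≥0} (h : r ≤ s) :
    truncScale n x s * r ≤ truncScale n x r * s := by
  induction n with
  | zero => rw [truncScale_zero, truncScale_zero, mul_comm]
  | succ n ih =>
    by_cases hx : x n = 0
    · simpa only [truncScale_succ_of_eq hx] using ih
    · simp only [truncScale_succ_of_ne hx]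
      rw [min_mul_of_nonneg _ _ (zero_le (a := s))]
      refine le_min ((mul_le_mul_left (min_le_left _ _) r).trans (le_of_eq (by ring)))
        ((mul_le_mul_left (min_le_right _ _) r).trans ?_)
      rw [add_mul, add_mul]
      gcongr

theorem exists_mem_level (x : levelOmega) : ∃ n, (x : Baire) ∈ level n :=
  Set.mem_iUnion.1 x.2

theorem mem_level_rank (x : levelOmega) : (x : Baire) ∈ level (rank x) :=
  Nat.sInf_mem (exists_mem_level x)

theorem rank_le {x : levelOmega} {n : ℕ} (h : (x : Baire) ∈ level n) : rank x ≤ n :=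
  Nat.sInf_le h

theorem truncScale_of_mem {m n : ℕ} {x : Baire} (h : x ∈ level m) (hmn : m ≤ n) (r : ℝ≥0) :
    truncScale n x r = truncScale m x r := by
  induction n, hmn using Nat.le_induction with
  | base => rfl
  | succ n hmn ih => rw [truncScale_succ_of_eq (h n hmn), ih]

theorem gammaZero_pos {n : ℕ} {x : levelOmega} (h : (x : Baire) ∈ level n) (r : ℝ≥0) :
    gammaZero (Letter.pos x) r = truncScale n x r := by
  rw [truncScale_of_mem (mem_level_rank x) (rank_le h)]
  unfold truncScale
  rw [trunc_eq_self (mem_level_rank x)]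
  rfl

theorem gammaZero_e (r : ℝ≥0) : gammaZero Letter.e r = r := rfl

theorem gammaZero_inv (a : Letter levelOmega) (r : ℝ≥0) : gammaZero a⁻¹ r = gammaZero a r := by
  cases a <;> rfl

theorem nndist_pos_eq {x y : Baire} (h : x ≠ y) :
    nndist (Letter.pos x) (Letter.pos y) = (1 / 2) ^ PiNat.firstDiff x y := by
  apply NNReal.coe_injective
  change baireDist x y = _
  unfold baireDist
  rw [if_neg h]
  push_cast
  rfl

theorem nndist_pos_le {k : ℕ} {x y : Baire} (h : ∀ i < k, x i = y i) :
    nndist (Letter.pos x) (Letter.pos y) ≤ (1 / 2) ^ k := by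
  by_cases hxy : x = y
  · rw [hxy, nndist_self]
    exact zero_le
  · rw [nndist_pos_eq hxy]
    refine pow_le_pow_of_le_one zero_le (by simp) ?_
    by_contra! hk
    exact PiNat.apply_firstDiff_ne hxy (h _ hk)

theorem nndist_pos_ne_le {k : ℕ} {x y : Baire} (h : x k ≠ y k) :
    (1 / 2) ^ k ≤ nndist (Letter.pos x) (Letter.pos y) := by
  rw [nndist_pos_eq fun e => h (congrFun e k)]
  refine pow_le_pow_of_le_one zero_le (by simp) ?_
  by_contra! hk
  exact h (PiNat.apply_eq_of_lt_firstDiff hk)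

theorem gammaZero_pos_le (x y : levelOmega) (r : ℝ≥0) :
    gammaZero (Letter.pos x) r ≤ gammaZero (Letter.pos y) r +
      nndist (Letter.pos (x : Baire)) (Letter.pos (y : Baire)) := by
  obtain ⟨m, hm⟩ := exists_mem_level x
  obtain ⟨n, hn⟩ := exists_mem_level y
  by_cases h : x = y
  · rw [h]
    exact le_self_add
  rw [gammaZero_pos (level_mono (le_max_left m n) hm),
    gammaZero_pos (level_mono (le_max_right m n) hn),
    nndist_pos_eq (fun e => h (Subtype.ext e))]
  exact truncScale_le_of_agree (fun i hi => PiNat.apply_eq_of_lt_firstDiff hi) _ r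

theorem gammaZero_le_add_one (a : Letter levelOmega) (r : ℝ≥0) : gammaZero a r ≤ r + 1 := by
  have key (x : levelOmega) : gammaZero (Letter.pos x) r ≤ r + 1 := by
    rw [gammaZero_pos (mem_level_rank x)]
    exact truncScale_le_add 0 _ _ _
  cases a
  · exact le_self_add
  · exact key _
  · exact key _

theorem isGood_gammaZero : IsGood gammaZero where
  g1 a b r := by
    -- Letters of different kinds are at distance 1, and every scale lies between r and r + 1.
    have far (h : nndist a b = 1) : gammaZero a r ≤ gammaZero b r + nndist a b := by
      rw [h]
      exact (gammaZero_le_add_one a r).trans (add_le_add_left (gammaZero.le_map b r) 1)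
    cases a <;> cases b <;>
      first
      | exact gammaZero_pos_le _ _ r
      | exact far (NNReal.coe_injective rfl)
      | exact le_self_add
  g2 a := by
    have key (x : levelOmega) :
        AntitoneOn (fun r => gammaZero (Letter.pos x) r / r) (Set.Ioi 0) := by
      intro r hr s hs hrs
      simp only [gammaZero_pos (mem_level_rank x)]
      rw [div_le_div_iff₀ hs hr]
      exact truncScale_mul_le _ _ hrs
    cases a
    · intro r hr s hs _
      simp only [gammaZero_e]
      rw [div_self (Set.mem_Ioi.1 hr).ne', div_self (Set.mem_Ioi.1 hs).ne']
    · exact key _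
    · exact key _
  g3 a r s := by
    have key (x : levelOmega) :
        gammaZero (Letter.pos x) r + s ≤ gammaZero (Letter.pos x) (r + s) := by
      simp only [gammaZero_pos (mem_level_rank x)]
      exact truncScale_add _ _ _ _
    cases a
    · exact le_rfl
    · exact key _
    · exact key _

end Baire

/-! ### Good scales are adequate -/

section Adequate

variable {X : Type*} [MetricSpace (Letter X)] [IsUltrametricDist (Letter X)]

theorem IsGood.mul_le {Γ : Scale X} (h : IsGood Γ) (x : Letter X) {r s : ℝ≥0} (hrs : r ≤ s) :
    Γ x s * r ≤ Γ x r * s := by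
  rcases eq_or_lt_of_le (zero_le (a := r)) with rfl | hr
  · rw [mul_zero]
    exact zero_le
  · exact (div_le_div_iff₀ (hr.trans_le hrs) hr).1 (h.g2 x hr (hr.trans_le hrs) hrs)

/-- The minimum at r + s is split in proportion r : s. The first share is charged to x and the
second to y, and (G2) bounds the shares by Γ(x, r) and Γ(y, s). -/
theorem IsGood.min_le_add {Γ : Scale X} (h : IsGood Γ) (x y : Letter X) (r s : ℝ≥0) :
    min (Γ x (r + s)) (Γ y (r + s)) ≤ Γ x r + Γ y s := by
  rcases eq_or_lt_of_le (zero_le (a := r + s)) with h0 | hpos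
  · refine (min_le_left _ _).trans ?_
    rw [← h0, (Γ.eq_zero_iff x 0).2 rfl]
    exact zero_le
  · refine le_of_mul_le_mul_right ?_ hpos
    calc min (Γ x (r + s)) (Γ y (r + s)) * (r + s)
        = min (Γ x (r + s)) (Γ y (r + s)) * r + min (Γ x (r + s)) (Γ y (r + s)) * s := mul_add _ _ _
      _ ≤ Γ x (r + s) * r + Γ y (r + s) * s := by
        gcongr
        · exact min_le_left _ _
        · exact min_le_right _ _
      _ ≤ Γ x r * (r + s) + Γ y s * (r + s) :=
        add_le_add (h.mul_le x le_self_add) (h.mul_le y le_add_self)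
      _ = (Γ x r + Γ y s) * (r + s) := (add_mul _ _ _).symm

theorem nndist_ultra (x y z : Letter X) : nndist x y ≤ max (nndist x z) (nndist y z) := by
  have h := IsUltrametricDist.dist_triangle_max x z y
  rw [dist_comm z y] at h
  exact_mod_cast h

/-- The value at `z` of a good scale, up to the distances to `z`, dominates the minimum of the
values at `x` and `y`. -/
theorem IsGood.min_add_nndist_le {Γ : Scale X} (h : IsGood Γ) (x y z : Letter X) (r : ℝ≥0) :
    min (Γ x r) (Γ y r) + nndist x y ≤ Γ z r + nndist x z + nndist y z := by
  -- The larger of the two distances alone bounds d(x, y) by the ultrametric inequality, so the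
  -- smaller one is left to pay for (G1) between z and the nearer letter.
  rcases le_total (nndist x z) (nndist y z) with hd | hd
  · have hxy := (nndist_ultra x y z).trans_eq (max_eq_right hd)
    exact add_le_add ((min_le_left _ _).trans (h.g1 x z r)) hxy
  · have hxy := (nndist_ultra x y z).trans_eq (max_eq_left hd)
    rw [add_right_comm]
    exact add_le_add ((min_le_right _ _).trans (h.g1 y z r)) hxy

/-- In both conditions a value at z may replace one at x or y; `min_add_nndist_le` absorbs this
case, and the triangle inequality the other one. (A1) then needs only `min_le_add`, and (A2) only
(G3). -/
theorem IsGood.isAdequate {Γ : Scale X} (h : IsGood Γ) : IsAdequate Γ where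
  a1 x y z r₁ r₂ := by
    have tri : nndist x y ≤ nndist x z + nndist y z := by
      rw [nndist_comm y z]
      exact nndist_triangle x z y
    set R := r₁ + r₂
    -- Each choice in the two minima leaves one letter at r₁ and one at r₂, which `min_le_add`
    -- merges. The minimum over all three letters covers every choice.
    have base : min (Γ x R) (min (Γ y R) (Γ z R)) ≤
        min (Γ x r₁) (Γ z r₁) + min (Γ y r₂) (Γ z r₂) := by
      have m1 := min_choice (Γ x r₁) (Γ z r₁)
      have m2 := min_choice (Γ y r₂) (Γ z r₂)
      rcases m1 with m1 | m1 <;> rcases m2 with m2 | m2 <;> rw [m1, m2]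
      · exact (min_le_min le_rfl (min_le_left _ _)).trans (h.min_le_add _ _ _ _)
      · exact (min_le_min le_rfl (min_le_right _ _)).trans (h.min_le_add _ _ _ _)
      · refine le_trans (le_min ?_ ?_) (h.min_le_add z y r₁ r₂)
        · exact (min_le_right _ _).trans (min_le_right _ _)
        · exact (min_le_right _ _).trans (min_le_left _ _)
      · refine le_trans (le_min ?_ ?_) (h.min_le_add z z r₁ r₂) <;>
          exact (min_le_right _ _).trans (min_le_right _ _)
    rw [show min (Γ x r₁) (Γ z r₁) + nndist x z + min (Γ y r₂) (Γ z r₂) + nndist y z =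
      min (Γ x r₁) (Γ z r₁) + min (Γ y r₂) (Γ z r₂) + (nndist x z + nndist y z) by ring]
    refine le_trans ?_ (add_le_add_left base _)
    rw [← min_assoc]
    rcases min_choice (min (Γ x R) (Γ y R)) (Γ z R) with m | m <;> rw [m]
    · exact add_le_add_right tri _
    · rw [← add_assoc]
      exact h.min_add_nndist_le x y z R
  a2 x y z r₁ r₂ r hr := by
    have tri : nndist x y ≤ nndist y z + nndist x z := by
      rw [nndist_comm y z, add_comm]
      exact nndist_triangle x z y
    -- Scales dominate the identity, so r exceeds r₁ by at least r₂ + d(y, z), and (G3) passes this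
    -- excess on to the value of the scale.
    have hle : r₁ + (r₂ + nndist y z) ≤ r := by
      rw [hr, ← add_assoc]
      gcongr
      exact le_min (Γ.le_map _ _) (Γ.le_map _ _)
    have step (a : Letter X) : Γ a r₁ + (r₂ + nndist y z) ≤ Γ a r :=
      (h.g3 a r₁ _).trans (Γ.mono a hle)
    rcases min_choice (Γ x r) (Γ z r) with m | m <;> rw [m]
    · calc min (Γ x r₁) (Γ y r₁) + nndist x y + r₂
          ≤ Γ x r₁ + (nndist y z + nndist x z) + r₂ := by
            gcongr
            exact min_le_left _ _
        _ = Γ x r₁ + (r₂ + nndist y z) + nndist x z := by ring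
        _ ≤ _ := add_le_add_left (step x) _
    · calc min (Γ x r₁) (Γ y r₁) + nndist x y + r₂
          ≤ Γ z r₁ + nndist x z + nndist y z + r₂ :=
            add_le_add_left (h.min_add_nndist_le x y z r₁) _
        _ = Γ z r₁ + (r₂ + nndist y z) + nndist x z := by ring
        _ ≤ _ := add_le_add_left (step z) _

end Adequate

/-! ### Conditions (S1), (S2) and (S3) with K = 1 -/

namespace Baire

theorem apply_pred_ne_zero {m : ℕ} {x : Baire} (hx : x ∈ level (m + 1) \ level m) : x m ≠ 0 := by
  intro h
  refine hx.2 fun i hi => ?_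
  rcases Nat.eq_or_lt_of_le hi with rfl | hlt
  · exact h
  · exact hx.1 i hlt

theorem gammaZero_of_rank {m : ℕ} {x : levelOmega} (hx : (x : Baire) ∈ level (m + 1) \ level m)
    (r : ℝ≥0) : gammaZero (Letter.pos x) r =
      min (slope (m + 1) x * r) (truncScale m x r + (1 / 2) ^ (m + 1)) := by
  rw [gammaZero_pos hx.1, truncScale_succ_of_ne (apply_pred_ne_zero hx)]

theorem gammaZero_truncOmega (n : ℕ) (x : Baire) (r : ℝ≥0) :
    gammaZero (Letter.pos (truncOmega n x)) r = truncScale n x r := by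
  rw [gammaZero_pos (trunc_mem_level n x)]
  exact truncScale_trunc le_rfl x r

/-- This is where K = 1 enters: half of the distance from x to π_m(x) is at most the additive
constant of the recursion at stage m + 1, so y = π_m(x) serves in (S1) and (S2). -/
theorem half_mul_nndist_truncOmega_le (m : ℕ) (x : levelOmega) :
    (1 / 2) ^ 1 * nndist (Letter.pos x) (Letter.pos (truncOmega m x)) ≤ (1 / 2 : ℝ≥0) ^ (m + 1) := by
  rw [pow_one, pow_succ' _ m]
  gcongr
  exact nndist_pos_le (x := (x : Baire)) (y := trunc m x) fun i hi => by simp [trunc, hi]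

theorem condS1_gammaZero : CondS1 gammaZero 1 := by
  intro m hm x hx r hr
  obtain ⟨m, rfl⟩ := Nat.exists_eq_succ_of_ne_zero hm.ne'
  simp only [Nat.succ_eq_add_one, Nat.add_sub_cancel] at hx hr ⊢
  refine ⟨truncOmega m x, trunc_mem_level m x, (min_le_right _ _).trans ?_⟩
  refine (add_le_add_right (half_mul_nndist_truncOmega_le m x) _).trans ?_
  rw [gammaZero_of_rank hx, gammaZero_truncOmega]
  refine le_min ?_ le_rfl
  rw [slope_succ, add_mul]
  refine add_le_add (truncScale_le_slope m x r) ?_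
  -- The last entry is nonzero, so the new term of the slope is at least 2^6. Multiplied by the
  -- threshold 2^{-(m+7)} it gives the constant 2^{-(m+1)}.
  have hx0 : 1 ≤ ∑ i ∈ Finset.range (m + 1), (x : Baire) i := by
    rw [Finset.sum_range_succ]
    have := apply_pred_ne_zero hx
    omega
  calc (1 / 2 : ℝ≥0) ^ (m + 1) = 2 ^ 5 * 2 ^ 1 * (1 / 2) ^ (m + 1 + 1 + 5) := by
        rw [add_assoc (m + 1), pow_add _ (m + 1), mul_left_comm]
        norm_num
    _ ≤ 2 ^ 5 * 2 ^ (∑ i ∈ Finset.range (m + 1), (x : Baire) i) * r := by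
        gcongr
        norm_num

theorem condS3_gammaZero : CondS3 gammaZero 1 := by
  intro m hm x hx r hr
  obtain ⟨m, rfl⟩ := Nat.exists_eq_succ_of_ne_zero hm.ne'
  simp only [Nat.succ_eq_add_one, Nat.add_sub_cancel] at hx hr
  rw [gammaZero_of_rank hx]
  refine le_min (mul_le_mul_left (le_trans (by norm_num) (le_slope _ _)) r) ?_
  -- In the additive branch the constant 2^{-(m+1)} suffices by itself, as 8r ≤ 2^{-(m+4)}.
  refine le_trans ?_ (le_add_self)
  calc 8 * r ≤ 8 * (1 / 2) ^ (m + 1 + 1 + 5) := by gcongr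
    _ = 1 / 8 * (1 / 2) ^ (m + 1) := by
      rw [add_assoc (m + 1), pow_add _ (m + 1), mul_left_comm, mul_comm]
      norm_num
    _ ≤ _ := mul_le_of_le_one_left zero_le ((div_le_one (by norm_num)).2 (by norm_num))

theorem finite_level_inter_le (m c : ℕ) :
    {x : Baire | x ∈ level m ∧ ∀ i < m, x i ≤ c}.Finite := by
  have h : (Set.pi Set.univ fun i : Fin m => Set.Iic c).Finite :=
    Set.Finite.pi fun _ => Set.finite_Iic c
  refine Set.Finite.of_finite_image (f := fun (x : Baire) (i : Fin m) => x i)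
    (h.subset ?_) ?_
  · rintro _ ⟨x, hx, rfl⟩ i -
    exact hx.2 i i.2
  · intro x hx y hy hxy
    funext i
    rcases lt_or_ge i m with hi | hi
    · exact congrFun hxy ⟨i, hi⟩
    · rw [hx.1 i hi, hy.1 i hi]

/-- Testing an exceptional x against its truncation rules out the additive branch. So the slope
times r is small while r > 2^{-k}, which bounds the sum of the entries of x by k and leaves finitely
many x. -/
theorem condS2_gammaZero : CondS2 gammaZero 1 := by
  intro m hm k hk
  obtain ⟨m, rfl⟩ := Nat.exists_eq_succ_of_ne_zero hm.ne'
  simp only [Nat.succ_eq_add_one] at hk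
  refine Set.Finite.of_finite_image (f := Subtype.val)
    ((finite_level_inter_le (m + 1) k).subset ?_) Subtype.val_injective.injOn
  rintro _ ⟨x, ⟨hx, r, hr, h⟩, rfl⟩
  simp only [Nat.succ_eq_add_one, Nat.add_sub_cancel] at hx hr h
  refine ⟨hx.1, fun i hi => ?_⟩
  have h1 := h (truncOmega m x) (trunc_mem_level m x)
  rw [gammaZero_of_rank hx, gammaZero_truncOmega] at h1
  have h2 : slope (m + 1) x * r < 1 := by
    rcases min_lt_iff.1 h1 with h1 | h1
    · exact (h1.trans_le (min_le_left _ _)).trans (by norm_num)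
    · exact absurd (h1.trans_le ((min_le_right _ _).trans
        (add_le_add_right (half_mul_nndist_truncOmega_le m x) _))) (lt_irrefl _)
  have h3 : (2 : ℝ≥0) ^ (∑ i ∈ Finset.range (m + 1), (x : Baire) i) ≤ slope (m + 1) x := by
    rw [slope_succ]
    refine le_trans ?_ le_add_self
    exact le_mul_of_one_le_left zero_le (by norm_num)
  have h4 : (2 : ℝ≥0) ^ (∑ i ∈ Finset.range (m + 1), (x : Baire) i) * (1 / 2) ^ k < 1 :=
    (mul_le_mul' h3 hr.1.le).trans_lt h2
  rw [one_div, inv_pow, ← div_eq_mul_inv, div_lt_one (by positivity)] at h4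
  have h5 := (pow_lt_pow_iff_right₀ (one_lt_two (α := ℝ≥0))).1 h4
  exact (Finset.single_le_sum (f := fun i => (x : Baire) i) (fun _ _ => zero_le)
    (Finset.mem_range.2 hi)).trans h5.le

/-! ### The regular extension to the Baire space -/

/-- The pointwise limit of the scales `Γ₀(π_n(x), ·)`. -/
def limScale (x : Baire) (r : ℝ≥0) : ℝ≥0 := ⨆ n, truncScale n x r

theorem bddAbove_truncScale (x : Baire) (r : ℝ≥0) :
    BddAbove (Set.range fun n => truncScale n x r) :=
  ⟨r + 1, by rintro _ ⟨n, rfl⟩; exact truncScale_le_add 0 n x r⟩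

theorem truncScale_le_limScale (n : ℕ) (x : Baire) (r : ℝ≥0) : truncScale n x r ≤ limScale x r :=
  le_ciSup (bddAbove_truncScale x r) n

theorem limScale_le (n : ℕ) (x : Baire) (r : ℝ≥0) :
    limScale x r ≤ truncScale n x r + (1 / 2) ^ n :=
  ciSup_le fun k => truncScale_le_add n k x r

theorem tendsto_truncScale (x : Baire) (r : ℝ≥0) :
    Tendsto (fun n => truncScale n x r) atTop (𝓝 (limScale x r)) :=
  tendsto_atTop_ciSup (truncScale_mono x r) (bddAbove_truncScale x r)

theorem limScale_of_mem {n : ℕ} {x : Baire} (h : x ∈ level n) (r : ℝ≥0) :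
    limScale x r = truncScale n x r := by
  refine le_antisymm (ciSup_le fun k => ?_) (truncScale_le_limScale n x r)
  rcases le_total n k with hk | hk
  · exact (truncScale_of_mem h hk r).le
  · exact truncScale_mono x r hk

theorem limScale_mono (x : Baire) : Monotone (limScale x) := fun _ s h =>
  ciSup_mono (bddAbove_truncScale x s) fun _ => gammaLevel_mono _ _ h

theorem limScale_zero (x : Baire) : limScale x 0 = 0 :=
  le_antisymm (ciSup_le fun n => (truncScale_le_slope n x 0).trans_eq (mul_zero _)) zero_le

theorem le_limScale (x : Baire) (r : ℝ≥0) : r ≤ limScale x r := truncScale_le_limScale 0 x r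

/-- The slopes may be unbounded in n, so n is fixed first: the limit is at most a linear function of
r plus 2^{-n}. -/
theorem tendsto_limScale_zero (x : Baire) : Tendsto (limScale x) (𝓝 0) (𝓝 0) := by
  refine tendsto_order.2 ⟨fun a ha => absurd ha (not_lt_of_ge zero_le), fun ε hε => ?_⟩
  obtain ⟨n, hn⟩ := exists_pow_lt_of_lt_one hε (by simpa using NNReal.half_lt_self one_ne_zero :
    (1 / 2 : ℝ≥0) < 1)
  have h : Tendsto (fun r : ℝ≥0 => slope n x * r + (1 / 2) ^ n) (𝓝 0) (𝓝 ((1 / 2) ^ n)) := by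
    have h := (continuous_const_mul (slope n x)).tendsto (0 : ℝ≥0)
    rw [mul_zero] at h
    simpa using h.add_const ((1 / 2 : ℝ≥0) ^ n)
  filter_upwards [h.eventually (gt_mem_nhds hn)] with r hr
  exact ((limScale_le n x r).trans (add_le_add_left (truncScale_le_slope n x r) _)).trans_lt hr

/-- The regular scale on the letters over the Baire space that extends `Γ₀`. -/
def gammaLim : Scale Baire where
  toFun a r := match a with
    | Letter.e => r
    | Letter.pos x => limScale x r
    | Letter.neg x => limScale x r
  map_e _ := rfl
  le_map a r := by
    cases a
    · exact le_rfl
    all_goals exact le_limScale _ _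
  eq_zero_iff a r := by
    have key (x : Baire) : limScale x r = 0 ↔ r = 0 :=
      ⟨fun h => le_antisymm (h ▸ le_limScale x r) zero_le, fun h => h ▸ limScale_zero x⟩
    cases a
    · exact Iff.rfl
    all_goals exact key _
  mono a := by
    cases a
    · exact fun _ _ h => h
    all_goals exact limScale_mono _
  tendsto_zero a := by
    cases a
    · exact tendsto_id
    all_goals exact tendsto_limScale_zero _

theorem isRegular_gammaLim : IsRegular gammaLim := by
  intro a r n
  have key (x : Baire) : limScale (trunc n x) r ≤ limScale x r := by
    rw [limScale_of_mem (trunc_mem_level n x), truncScale_trunc le_rfl]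
    exact truncScale_le_limScale n x r
  cases a
  · exact le_rfl
  all_goals exact key _

theorem gammaLim_map_val (a : Letter levelOmega) (r : ℝ≥0) :
    gammaLim (a.map Subtype.val) r = gammaZero a r := by
  have key (x : levelOmega) : limScale x r = gammaZero (Letter.pos x) r := by
    rw [limScale_of_mem (mem_level_rank x), gammaZero_pos (mem_level_rank x)]
  cases a
  · rfl
  all_goals exact key _

theorem tendsto_gammaZero_truncOmega (a : Letter Baire) (r : ℝ≥0) :
    Tendsto (fun n => gammaZero (a.map (truncOmega n)) r) atTop (𝓝 (gammaLim a r)) := by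
  have key (x : Baire) :
      Tendsto (fun n => gammaZero (Letter.pos (truncOmega n x)) r) atTop (𝓝 (limScale x r)) := by
    simp only [gammaZero_truncOmega]
    exact tendsto_truncScale x r
  cases a
  · exact tendsto_const_nhds
  all_goals exact key _

end Baire

/-! ### Maximality and functoriality of the norm -/

section WordNorm

variable {X Y : Type*}

theorem Letter.map_inv (f : X → Y) (a : Letter X) : a⁻¹.map f = (a.map f)⁻¹ := by
  cases a <;> rfl

theorem Letter.toFree_map (f : X → Y) (a : Letter X) :
    (a.map f).toFree = FreeGroup.map f a.toFree := by
  cases a <;> simp [Letter.map, Letter.toFree]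

theorem evalWord_single (a : Letter X) : evalWord [a] = a.toFree := by simp [evalWord]

theorem evalWord_pair (a b : Letter X) : evalWord [a, b] = a.toFree * b.toFree := by
  simp [evalWord]

variable [MetricSpace (Letter X)] [MetricSpace (Letter Y)]

/-- Splitting a match at θ(0) or stripping its outer pair shows that all realized values arise from
four rules. Matches and their re-indexing need not be mentioned afterwards. -/
theorem Realizes.induction {Γ : Scale X} {P : List (Letter X) → ℝ≥0 → Prop}
    (single : ∀ x, P [x] (nndist Letter.e x))
    (pair : ∀ a b, P [a, b] (nndist a⁻¹ b))
    (append : ∀ w v r s, w ≠ [] → v ≠ [] → P w r → P v s → P (w ++ v) (r + s))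
    (wrap : ∀ a m y r, m ≠ [] → P m r →
      P (a :: (m ++ [y])) (nndist a⁻¹ y + min (Γ a⁻¹ r) (Γ y r)))
    {w : List (Letter X)} {r : ℝ≥0} (hw : w ≠ []) (h : Realizes Γ w r) : P w r := by
  obtain ⟨θ, hθ, rfl⟩ := h
  generalize hn : w.length = n at hθ
  induction n using Nat.strong_induction_on generalizing w θ with
  | _ n ih =>
    rcases word_cases w hw with ⟨x, rfl⟩ | ⟨a, m, y, rfl⟩
    · simpa [preNorm] using single x
    have hl : m.length + 2 = n := by simpa using hn
    by_cases hs : θ 0 + 1 < n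
    · rw [preNorm_split Γ _ θ (by omega)]
      generalize (a :: (m ++ [y])) = w at *
      have ht : w.take (θ 0 + 1) ≠ [] := by
        rw [← List.length_pos_iff]; simp; omega
      have hd : w.drop (θ 0 + 1) ≠ [] := by
        rw [← List.length_pos_iff]; simp; omega
      have key := append _ _ _ _ ht hd
        (ih (θ 0 + 1) (by omega) ht θ (by simp; omega) (isMatch_take hθ hs))
        (ih (n - (θ 0 + 1)) (by omega) hd _ (by simp; omega) (isMatch_drop hθ hs))
      rwa [List.take_append_drop] at key
    · have h0 := hθ.lt 0 (by omega)
      by_cases hm : m = []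
      · subst hm
        simp at hl
        simpa [preNorm_pair Γ a y θ (by omega)] using pair a y
      · have hlt : m.length < θ 0 := by omega
        rw [preNorm_wrap Γ a y m hm θ hlt]
        have hi := isMatch_inner (n := m.length) (by rw [hl]; exact hθ) hlt
        exact wrap a m y _ hm (ih _ (by omega) hm _ rfl hi)

/-- The norm `N_Γ` is the largest subadditive function that is bounded by the distance on
quotients of letters and by the scale on conjugates by letters. -/
theorem le_wordNorm {Γ : Scale X} {L : FreeGroup X → ℝ≥0}
    (mul : ∀ g h, L (g * h) ≤ L g + L h)
    (div : ∀ a b : Letter X, L (a.toFree⁻¹ * b.toFree) ≤ nndist a b)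
    (conj : ∀ (a : Letter X) g, L (a.toFree⁻¹ * g * a.toFree) ≤ Γ a (L g)) (g : FreeGroup X) :
    L g ≤ wordNorm Γ g := by
  refine le_of_forall_gt fun ε hε => ?_
  obtain ⟨w, r, hw, rfl, hr, hlt⟩ := exists_realizes_lt hε
  refine (Realizes.induction (P := fun w r => L (evalWord w) ≤ r) ?_ ?_ ?_ ?_ hw hr).trans_lt hlt
  · intro x
    simpa [evalWord_single, Letter.toFree] using div Letter.e x
  · intro a b
    simpa [evalWord_pair, Letter.toFree_inv] using div a⁻¹ b
  · intro w v r s _ _ h1 h2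
    rw [evalWord_append]
    exact (mul _ _).trans (add_le_add h1 h2)
  · intro a m y r _ h
    have e : evalWord (a :: (m ++ [y])) = a⁻¹.toFree⁻¹ * evalWord m * y.toFree := by
      rw [evalWord_cons, evalWord_append, evalWord_single, Letter.toFree_inv, inv_inv, mul_assoc]
    rw [e]
    generalize a⁻¹ = x
    generalize evalWord m = g at h
    -- The element x⁻¹gy is x⁻¹gx times x⁻¹y, and also x⁻¹y times y⁻¹gy; the two factorizations
    -- match the two terms of the minimum.
    rcases min_choice (Γ x r) (Γ y r) with m | m <;> rw [m]
    · calc L (x.toFree⁻¹ * g * y.toFree)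
          = L ((x.toFree⁻¹ * g * x.toFree) * (x.toFree⁻¹ * y.toFree)) := by congr 1; group
        _ ≤ Γ x (L g) + nndist x y := (mul _ _).trans (add_le_add (conj _ _) (div _ _))
        _ ≤ nndist x y + Γ x r := by
          rw [add_comm]
          exact add_le_add_right (Γ.mono x h) _
    · calc L (x.toFree⁻¹ * g * y.toFree)
          = L ((x.toFree⁻¹ * y.toFree) * (y.toFree⁻¹ * g * y.toFree)) := by congr 1; group
        _ ≤ nndist x y + Γ y (L g) := (mul _ _).trans (add_le_add (div _ _) (conj _ _))
        _ ≤ nndist x y + Γ y r := add_le_add_right (Γ.mono y h) _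

theorem evalWord_map (f : X → Y) (w : List (Letter X)) :
    evalWord (w.map (Letter.map f)) = FreeGroup.map f (evalWord w) := by
  induction w with
  | nil => simp [evalWord]
  | cons a w ih => rw [List.map_cons, evalWord_cons, evalWord_cons, map_mul, ih,
      Letter.toFree_map]

/-- A map of letters that increases neither the distance nor the scale does not increase the
norm. -/
theorem wordNorm_map_le {Γ : Scale X} {Γ' : Scale Y} {f : X → Y}
    (hd : ∀ a b : Letter X, nndist (a.map f) (b.map f) ≤ nndist a b)
    (hΓ : ∀ (a : Letter X) r, Γ' (a.map f) r ≤ Γ a r) (g : FreeGroup X) :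
    wordNorm Γ' (FreeGroup.map f g) ≤ wordNorm Γ g := by
  refine le_of_forall_gt fun ε hε => ?_
  obtain ⟨w, r, hw, rfl, hr, hlt⟩ := exists_realizes_lt hε
  have key : ∃ s ≤ r, Realizes Γ' (w.map (Letter.map f)) s := by
    refine Realizes.induction (P := fun w r => ∃ s ≤ r, Realizes Γ' (w.map (Letter.map f)) s)
      ?_ ?_ ?_ ?_ hw hr
    · intro x
      exact ⟨_, hd Letter.e x, realizes_single Γ' (x.map f)⟩
    · intro a b
      refine ⟨_, hd a⁻¹ b, ?_⟩
      rw [Letter.map_inv]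
      exact realizes_pair Γ' _ _
    · rintro w v r s hw hv ⟨r', hr', h1⟩ ⟨s', hs', h2⟩
      refine ⟨r' + s', add_le_add hr' hs', ?_⟩
      rw [List.map_append]
      exact realizes_append (by simpa using hw) (by simpa using hv) h1 h2
    · rintro a m y r hm ⟨s, hs, h⟩
      refine ⟨_, ?_, by simpa using realizes_wrap (by simpa using hm) (a.map f) (y.map f) h⟩
      rw [← Letter.map_inv]
      exact add_le_add (hd _ _) (min_le_min ((hΓ _ _).trans (Γ.mono _ hs))
        ((hΓ _ _).trans (Γ.mono _ hs)))
  obtain ⟨s, hs, h⟩ := key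
  rw [← evalWord_map]
  exact (wordNorm_le (by simpa using hw) h).trans_lt (hs.trans_lt hlt)

theorem wordNorm_div_le (Γ : Scale X) (a b : Letter X) :
    wordNorm Γ (a.toFree⁻¹ * b.toFree) ≤ nndist a b := by
  have h := wordNorm_le (by simp) (realizes_pair Γ a⁻¹ b)
  rwa [evalWord_pair, Letter.toFree_inv, Letter.inv_inv'] at h

end WordNorm

/-! ### Extending homomorphisms to the completion -/

namespace FBar

variable {X : Type*} [MetricSpace (Letter X)] [InvIsometric X] (Γ : Scale X)

theorem continuous_ofFree_of_discrete {α : Type*} [TopologicalSpace α] [DiscreteTopology α]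
    (f : α → FreeGroup X) : Continuous fun a => ofFree Γ (f a) :=
  continuous_of_discreteTopology

theorem denseRange_ofFree : DenseRange (ofFree Γ) := (isDenseInducing_coe Γ).dense

theorem dist_ofFree (g h : FreeGroup X) :
    dist (ofFree Γ g) (ofFree Γ h) = (bigDelta Γ g h : ℝ) :=
  UniformSpace.Completion.dist_eq _ _

/-- A homomorphism from the free group that turns Cauchy filters into convergent ones extends to
the completion. -/
theorem exists_extension {K : Type*} [Group K] [TopologicalSpace K] [IsTopologicalGroup K]
    [T2Space K] (f : FreeGroup X →* K)
    (hf : ∀ F : Filter (ScaledFreeGroup Γ), Cauchy F →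
      ∃ c, Tendsto (fun g => f (ScaledFreeGroup.val Γ g)) F (𝓝 c)) :
    ∃ Φ : FBar Γ →* K, Continuous Φ ∧ ∀ w, Φ (ofFree Γ w) = f w := by
  have hd := isDenseInducing_coe Γ
  have hlim : ∀ b, ∃ c, Tendsto (fun g => f (ScaledFreeGroup.val Γ g))
      (comap (coe Γ) (𝓝 b)) (𝓝 c) := fun b => by
    have := hd.comap_nhds_neBot b
    exact hf _ (cauchy_nhds.comap (isUniformInducing_coe Γ).comap_uniformity.le)
  have hc : Continuous (hd.extend fun g => f (ScaledFreeGroup.val Γ g)) :=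
    hd.continuous_extend hlim
  have hof : ∀ w, hd.extend (fun g => f (ScaledFreeGroup.val Γ g)) (ofFree Γ w) = f w :=
    fun w => hd.extend_eq' hlim w
  refine ⟨⟨⟨hd.extend fun g => f (ScaledFreeGroup.val Γ g), ?_⟩, ?_⟩, hc, hof⟩
  · rw [← map_one (ofFree Γ), hof, map_one]
  · intro a b
    refine isClosed_property2 (denseRange_ofFree Γ)
      (p := fun a b => hd.extend (fun g => f (ScaledFreeGroup.val Γ g)) (a * b) =
        hd.extend (fun g => f (ScaledFreeGroup.val Γ g)) a *
          hd.extend (fun g => f (ScaledFreeGroup.val Γ g)) b)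
      (isClosed_eq (hc.comp continuous_mul)
        ((hc.comp continuous_fst).mul (hc.comp continuous_snd))) (fun v w => ?_) a b
    rw [← map_mul, hof, hof, hof, map_mul]

end FBar

/-! ### Projections to the finite levels and the inverse limit -/

namespace Baire

instance (n : ℕ) : DiscreteTopology (FreeGroup (level n)) := ⟨rfl⟩

theorem nndist_trunc_le (n : ℕ) (x y : Baire) :
    nndist (Letter.pos (trunc n x)) (Letter.pos (trunc n y)) ≤
      nndist (Letter.pos x) (Letter.pos y) := by
  by_cases hxy : x = y
  · rw [hxy, nndist_self]
    exact zero_le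
  · rw [nndist_pos_eq hxy]
    refine nndist_pos_le fun i hi => ?_
    simp only [trunc, PiNat.apply_eq_of_lt_firstDiff hi]

theorem nndist_map_truncOmega_le (n : ℕ) (a b : Letter levelOmega) :
    nndist (a.map fun x : levelOmega => truncOmega n x) (b.map fun x : levelOmega => truncOmega n x) ≤ nndist a b := by
  cases a <;> cases b <;> first | exact nndist_trunc_le n _ _ | exact le_rfl

theorem gammaZero_map_truncOmega_le (n : ℕ) (a : Letter levelOmega) (r : ℝ≥0) :
    gammaZero (a.map fun x : levelOmega => truncOmega n x) r ≤ gammaZero a r := by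
  have key (x : levelOmega) :
      gammaZero (Letter.pos (truncOmega n x)) r ≤ gammaZero (Letter.pos x) r := by
    rw [gammaZero_truncOmega, gammaZero_pos (mem_level_rank x), ← limScale_of_mem (mem_level_rank x)]
    exact truncScale_le_limScale _ _ _
  cases a
  · exact le_rfl
  all_goals exact key _

/-- The projection `F(𝒩_ω) → F(𝒩_n)`. -/
def proj (n : ℕ) : FreeGroup levelOmega →* FreeGroup (level n) :=
  FreeGroup.map fun x : levelOmega => truncLevel n x

/-- The inclusion `F(𝒩_n) → F(𝒩_ω)`. -/
def incl (n : ℕ) : FreeGroup (level n) →* FreeGroup levelOmega :=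
  FreeGroup.map fun x : level n => truncOmega n x

theorem incl_proj (n : ℕ) (w : FreeGroup levelOmega) :
    incl n (proj n w) = FreeGroup.map (fun x : levelOmega => truncOmega n x) w := by
  rw [incl, proj, FreeGroup.map.comp]
  congr 2
  funext x
  exact Subtype.ext (trunc_trunc le_rfl _)

theorem proj_incl_of_le {m n : ℕ} (h : m ≤ n) (w : FreeGroup (level n)) :
    proj m (incl n w) = FreeGroup.map (fun x : level n => truncLevel m x) w := by
  rw [incl, proj, FreeGroup.map.comp]
  congr 2
  funext x
  exact Subtype.ext (trunc_trunc h _)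

theorem map_truncLevel_proj (n : ℕ) (w : FreeGroup levelOmega) :
    FreeGroup.map (fun x : level (n + 1) => truncLevel n x) (proj (n + 1) w) = proj n w := by
  rw [proj, proj, FreeGroup.map.comp]
  congr 2
  funext x
  exact Subtype.ext (trunc_trunc n.le_succ _)

/-- A word involves finitely many generators, each of finite rank. -/
theorem eventually_incl_proj (w : FreeGroup levelOmega) : ∀ᶠ n in atTop, incl n (proj n w) = w := by
  have letter (x : levelOmega) : ∀ᶠ n in atTop, incl n (proj n (FreeGroup.of x)) = .of x := by
    filter_upwards [eventually_ge_atTop (rank x)] with n hn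
    rw [incl_proj, FreeGroup.map.of]
    congr 1
    exact Subtype.ext (trunc_eq_self (level_mono hn (mem_level_rank x)))
  induction w using FreeGroup.induction_on with
  | C1 => simp
  | of x => exact letter x
  | inv_of x _ =>
    filter_upwards [letter x] with n hn
    rw [map_inv, map_inv, hn]
  | mul g h hg hh =>
    filter_upwards [hg, hh] with n h1 h2
    rw [map_mul, map_mul, h1, h2]

theorem wordNorm_incl_proj_le (n : ℕ) (w : FreeGroup levelOmega) :
    wordNorm gammaZero (incl n (proj n w)) ≤ wordNorm gammaZero w := by
  rw [incl_proj]
  exact wordNorm_map_le (nndist_map_truncOmega_le n) (gammaZero_map_truncOmega_le n) w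

theorem bigDelta_incl_proj_le (n : ℕ) (v w : FreeGroup levelOmega) :
    bigDelta gammaZero (incl n (proj n v)) (incl n (proj n w)) ≤ bigDelta gammaZero v w := by
  simp only [bigDelta, scaleDelta, ← map_inv, ← map_mul]
  exact max_le_max (wordNorm_incl_proj_le n _) (wordNorm_incl_proj_le n _)

theorem half_pow_le_nndist {n : ℕ} {a b : Letter levelOmega}
    (h : proj n a.toFree ≠ proj n b.toFree) : (1 / 2) ^ n ≤ nndist a b := by
  have key (x y : levelOmega) (h : truncLevel n x ≠ truncLevel n y) :
      (1 / 2) ^ n ≤ nndist (Letter.pos (x : Baire)) (Letter.pos (y : Baire)) := by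
    have : ∃ i < n, (x : Baire) i ≠ (y : Baire) i := by
      by_contra! hc
      exact h (Subtype.ext (trunc_congr hc))
    obtain ⟨i, hi, hne⟩ := this
    exact (pow_le_pow_of_le_one zero_le (by simp) hi.le).trans (nndist_pos_ne_le hne)
  have far (hd : nndist a b = 1) : (1 / 2) ^ n ≤ nndist a b := by
    rw [hd]
    exact pow_le_one₀ zero_le (by simp)
  cases a <;> cases b <;>
    first
    | exact absurd rfl h
    | exact key _ _ fun e => h (by simp [proj, Letter.toFree, e])
    | exact far (NNReal.coe_injective rfl)

/-- The projection to `F(𝒩_n)` is trivial on small elements. -/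
theorem proj_eq_one_of_wordNorm_lt {n : ℕ} {w : FreeGroup levelOmega}
    (h : wordNorm gammaZero w < (1 / 2) ^ n) : proj n w = 1 := by
  classical
  by_contra hne
  -- The test function depends only on membership in the kernel. Normality makes it invariant under
  -- conjugation, and r ≤ Γ₀(a, r) then gives the condition on the scale. Letters with different
  -- projections are at distance at least 2^{-n}.
  have key := le_wordNorm (Γ := gammaZero)
    (L := fun g => if proj n g = 1 then 0 else (1 / 2) ^ n) ?_ ?_ ?_ w
  · rw [if_neg hne] at key
    exact absurd h (not_lt.2 key)
  · intro g h
    by_cases hg : proj n g = 1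
    · simp [hg]
    · simp only [hg, if_false]
      split_ifs <;> first | exact zero_le | exact le_self_add
  · intro a b
    split_ifs with hab
    · exact zero_le
    · exact half_pow_le_nndist fun e => hab (by rw [map_mul, map_inv, e, inv_mul_cancel])
  · intro a g
    refine le_trans ?_ (gammaZero.le_map a _)
    have e : proj n (a.toFree⁻¹ * g * a.toFree) = 1 ↔ proj n g = 1 := by
      rw [map_mul, map_mul, map_inv]
      nth_rw 2 [← inv_inv (proj n a.toFree)]
      exact conj_eq_one_iff
    simp only [e, le_rfl]

theorem exists_projBar (n : ℕ) : ∃ Φ : FBar gammaZero →* FreeGroup (level n), Continuous Φ ∧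
    ∀ w, Φ (FBar.ofFree gammaZero w) = proj n w := by
  have : IsTopologicalGroup (FreeGroup (level n)) :=
    { continuous_mul := continuous_of_discreteTopology
      continuous_inv := continuous_of_discreteTopology }
  refine FBar.exists_extension gammaZero (proj n) fun F hF => ?_
  obtain ⟨s, hs, hd⟩ := (Metric.cauchy_iff.1 hF).2 (((1 / 2 : ℝ≥0) ^ n : ℝ≥0) : ℝ) (by positivity)
  obtain ⟨c, hc⟩ := hF.1.nonempty_of_mem hs
  refine ⟨proj n (ScaledFreeGroup.val gammaZero c), ?_⟩
  refine tendsto_nhds_of_eventually_eq ?_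
  filter_upwards [hs] with g hg
  have h := ((dist_lt_iff gammaZero _ _ _).1 (hd c hc g hg)).1
  have h1 := proj_eq_one_of_wordNorm_lt h
  rw [map_mul, map_inv, inv_mul_eq_one] at h1
  exact h1.symm

/-- The extension of the projection `F(𝒩_ω) → F(𝒩_n)` to the completion. -/
def projBar (n : ℕ) : FBar gammaZero →* FreeGroup (level n) := (exists_projBar n).choose

theorem continuous_projBar (n : ℕ) : Continuous (projBar n) := (exists_projBar n).choose_spec.1

theorem projBar_ofFree (n : ℕ) (w : FreeGroup levelOmega) :
    projBar n (FBar.ofFree gammaZero w) = proj n w := (exists_projBar n).choose_spec.2 w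

theorem map_truncLevel_projBar (n : ℕ) (g : FBar gammaZero) :
    FreeGroup.map (fun x : level (n + 1) => truncLevel n x) (projBar (n + 1) g) = projBar n g := by
  refine isClosed_property (FBar.denseRange_ofFree gammaZero)
    (p := fun g => FreeGroup.map (fun x : level (n + 1) => truncLevel n x) (projBar (n + 1) g) =
      projBar n g) (isClosed_eq ?_ (continuous_projBar n)) (fun w => ?_) g
  · exact Continuous.comp continuous_of_discreteTopology (continuous_projBar (n + 1))
  · rw [projBar_ofFree, projBar_ofFree, map_truncLevel_proj]

/-- The homomorphism from the completion to the inverse limit. -/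
def toInvLimit : FBar gammaZero →* invLimit :=
  (MonoidHom.pi projBar).codRestrict invLimit fun g n => map_truncLevel_projBar n g

theorem continuous_toInvLimit : Continuous toInvLimit :=
  Continuous.subtype_mk (continuous_pi continuous_projBar) _

theorem dist_ofFree_incl_projBar_le (n : ℕ) (g h : FBar gammaZero) :
    dist (FBar.ofFree gammaZero (incl n (projBar n g)))
      (FBar.ofFree gammaZero (incl n (projBar n h))) ≤ dist g h := by
  have hc : Continuous fun g => FBar.ofFree gammaZero (incl n (projBar n g)) :=
    (FBar.continuous_ofFree_of_discrete gammaZero (incl n)).comp (continuous_projBar n)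
  refine isClosed_property2 (FBar.denseRange_ofFree gammaZero)
    (p := fun g h => dist (FBar.ofFree gammaZero (incl n (projBar n g)))
      (FBar.ofFree gammaZero (incl n (projBar n h))) ≤ dist g h)
    (isClosed_le ((hc.comp continuous_fst).dist (hc.comp continuous_snd)) continuous_dist)
    (fun v w => ?_) g h
  rw [projBar_ofFree, projBar_ofFree, FBar.dist_ofFree, FBar.dist_ofFree, NNReal.coe_le_coe]
  exact bigDelta_incl_proj_le n v w

/-- The maps are all 1-Lipschitz, and each element of the dense subgroup F(𝒩_ω) is eventually fixed,
so they converge to the identity everywhere. -/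
theorem tendsto_ofFree_incl_projBar (g : FBar gammaZero) :
    Tendsto (fun n => FBar.ofFree gammaZero (incl n (projBar n g))) atTop (𝓝 g) := by
  refine Metric.tendsto_nhds.2 fun ε hε => ?_
  obtain ⟨w, hw⟩ := (FBar.denseRange_ofFree gammaZero).exists_dist_lt g (half_pos hε)
  filter_upwards [eventually_incl_proj w] with n hn
  have h := dist_ofFree_incl_projBar_le n g (FBar.ofFree gammaZero w)
  rw [projBar_ofFree, hn] at h
  calc dist (FBar.ofFree gammaZero (incl n (projBar n g))) g
      ≤ _ + dist (FBar.ofFree gammaZero w) g := dist_triangle _ (FBar.ofFree gammaZero w) _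
    _ < ε / 2 + ε / 2 := add_lt_add_of_le_of_lt (h.trans hw.le) (by rwa [dist_comm])
    _ = ε := add_halves ε

theorem injective_toInvLimit : Function.Injective toInvLimit := by
  intro g h e
  refine tendsto_nhds_unique (tendsto_ofFree_incl_projBar g) ?_
  have e' : ∀ n, projBar n g = projBar n h := fun n => congrFun (congrArg Subtype.val e) n
  simp only [e']
  exact tendsto_ofFree_incl_projBar h

theorem map_truncLevel_of_mem_invLimit {x : ∀ n, FreeGroup (level n)} (hx : x ∈ invLimit)
    {m n : ℕ} (h : m ≤ n) : FreeGroup.map (fun y : level n => truncLevel m y) (x n) = x m := by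
  induction n, h using Nat.le_induction with
  | base =>
    have e : (fun y : level m => truncLevel m y) = id := by
      funext y
      exact Subtype.ext (trunc_eq_self y.2)
    rw [e, FreeGroup.map.id]
  | succ n hmn ih =>
    rw [← ih, ← hx n, FreeGroup.map.comp]
    congr 2
    funext y
    exact Subtype.ext (trunc_trunc hmn _).symm

/-- If the lifts of a coherent sequence converge, their limit has the prescribed coordinates: by
coherence the n-th projection of the m-th lift is x n for all m ≥ n. -/
theorem mem_range_projBar_iff (x : ∀ n, FreeGroup (level n)) :
    (∃ g, ∀ n, projBar n g = x n) ↔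
      x ∈ invLimit ∧ CauchySeq fun n => FBar.ofFree gammaZero (incl n (x n)) := by
  constructor
  · rintro ⟨g, hg⟩
    refine ⟨fun n => by rw [← hg, ← hg, map_truncLevel_projBar], ?_⟩
    simp only [← hg]
    exact (tendsto_ofFree_incl_projBar g).cauchySeq
  · rintro ⟨hx, hc⟩
    obtain ⟨g, hg⟩ := cauchySeq_tendsto_of_complete hc
    refine ⟨g, fun n => tendsto_nhds_unique (((continuous_projBar n).tendsto g).comp hg) ?_⟩
    refine tendsto_nhds_of_eventually_eq ?_
    filter_upwards [eventually_ge_atTop n] with m hm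
    rw [Function.comp_apply, projBar_ofFree, proj_incl_of_le hm,
      map_truncLevel_of_mem_invLimit hx hm]

theorem isClosed_invLimit : IsClosed (invLimit : Set (∀ n, FreeGroup (level n))) := by
  have e : (invLimit : Set (∀ n, FreeGroup (level n))) =
      ⋂ n, {g | FreeGroup.map (fun x : level (n + 1) => truncLevel n x) (g (n + 1)) = g n} := by
    ext g
    simp only [Set.mem_iInter]
    rfl
  rw [e]
  exact isClosed_iInter fun n => isClosed_eq
    (Continuous.comp continuous_of_discreteTopology (continuous_apply (n + 1))) (continuous_apply n)

/-- Cauchyness says that for each k some N works for all n ≥ N. The innermost condition is closed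
because the lifts depend continuously on coordinates in discrete groups. -/
theorem isPi03_range_projBar :
    IsPi03 {x : ∀ n, FreeGroup (level n) | ∃ g, ∀ n, projBar n g = x n} := by
  have hc (n : ℕ) : Continuous fun x : ∀ n, FreeGroup (level n) =>
      FBar.ofFree gammaZero (incl n (x n)) :=
    (FBar.continuous_ofFree_of_discrete gammaZero (incl n)).comp (continuous_apply n)
  refine ⟨fun k N => (invLimit : Set (∀ n, FreeGroup (level n))) ∩ ⋂ n ≥ N,
    {x | dist (FBar.ofFree gammaZero (incl n (x n))) (FBar.ofFree gammaZero (incl N (x N))) ≤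
      1 / ((k : ℝ) + 1)}, fun k N => ?_, ?_⟩
  · exact isClosed_invLimit.inter (isClosed_biInter fun n _ =>
      isClosed_le ((hc n).dist (hc N)) continuous_const)
  · ext x
    simp only [Set.mem_ofPred_eq, mem_range_projBar_iff, Set.mem_iInter, Set.mem_iUnion,
      Set.mem_inter_iff, SetLike.mem_coe]
    constructor
    · rintro ⟨hx, h⟩ k
      obtain ⟨N, hN⟩ := Metric.cauchySeq_iff'.1 h _ (Nat.one_div_pos_of_nat (n := k))
      exact ⟨N, hx, fun n hn => (hN n hn).le⟩
    · intro h
      refine ⟨(h 0).choose_spec.1, Metric.cauchySeq_iff'.2 fun ε hε => ?_⟩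
      obtain ⟨k, hk⟩ := exists_nat_one_div_lt hε
      obtain ⟨N, -, hN⟩ := h k
      exact ⟨N, fun n hn => (hN n hn).trans_lt hk⟩

end Baire

/-! ### 𝚷⁰₃ sets and the realization in S_∞ -/

theorem IsPi03.preimage {α β : Type*} [TopologicalSpace α] [TopologicalSpace β] {A : Set β}
    (hA : IsPi03 A) {f : α → β} (hf : Continuous f) : IsPi03 (f ⁻¹' A) := by
  obtain ⟨C, hC, rfl⟩ := hA
  exact ⟨fun i j => f ⁻¹' C i j, fun i j => (hC i j).preimage hf,
    by simp only [Set.preimage_iInter, Set.preimage_iUnion]⟩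

theorem IsPi03.inter_isClosed {α : Type*} [TopologicalSpace α] {A B : Set α}
    (hA : IsPi03 A) (hB : IsClosed B) : IsPi03 (A ∩ B) := by
  obtain ⟨C, hC, rfl⟩ := hA
  refine ⟨fun i j => C i j ∩ B, fun i j => (hC i j).inter hB, ?_⟩
  simp only [← Set.iUnion_inter, ← Set.iInter_inter]

namespace Baire

theorem isPi03_range_toInvLimit : IsPi03 (Set.range toInvLimit) := by
  have e : Set.range toInvLimit =
      Subtype.val ⁻¹' {x : ∀ n, FreeGroup (level n) | ∃ g, ∀ n, projBar n g = x n} := by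
    ext x
    simp only [Set.mem_range, Set.mem_preimage, Set.mem_ofPred_eq]
    exact exists_congr fun g => ⟨fun h n => h ▸ rfl, fun h => Subtype.ext (funext h)⟩
  rw [e]
  exact isPi03_range_projBar.preimage continuous_subtype_val

end Baire

theorem continuous_perm_coe : Continuous fun σ : Equiv.Perm ℕ => (σ : ℕ → ℕ) :=
  continuous_induced_dom

instance : T2Space (Equiv.Perm ℕ) :=
  T2Space.of_injective_continuous DFunLike.coe_injective continuous_perm_coe

theorem continuous_perm_apply (k : ℕ) : Continuous fun σ : Equiv.Perm ℕ => σ k :=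
  (continuous_apply k).comp continuous_perm_coe

section PermutationAction

variable {G : ℕ → Type*} [∀ n, Group (G n)] (E : (Σ n, G n) ≃ ℕ)

/-- The action of a product of groups on their disjoint union by left multiplication, transported
to `ℕ`. -/
def sigmaPerm : (∀ n, G n) →* Equiv.Perm ℕ where
  toFun x := E.permCongr (Equiv.sigmaCongrRight fun n => Equiv.mulLeft (x n))
  map_one' := by
    ext k
    simp
  map_mul' x y := by
    ext k
    simp

theorem sigmaPerm_apply (x : ∀ n, G n) (k : ℕ) :
    sigmaPerm E x k = E ⟨(E.symm k).1, x _ * (E.symm k).2⟩ := rfl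

/-- A left inverse of `sigmaPerm`. -/
def permCoord (σ : Equiv.Perm ℕ) (n : ℕ) : G n :=
  -- The default 1 is used when σ moves the base point out of the n-th copy. Only one value of σ is
  -- consulted, so continuity holds for any default.
  Function.extend (fun h : G n => E ⟨n, h⟩) id 1 (σ (E ⟨n, 1⟩))

theorem permCoord_sigmaPerm (x : ∀ n, G n) : permCoord E (sigmaPerm E x) = x := by
  funext n
  have hinj : Function.Injective fun h : G n => E ⟨n, h⟩ :=
    E.injective.comp sigma_mk_injective
  have e : sigmaPerm E x (E ⟨n, 1⟩) = (fun h : G n => E ⟨n, h⟩) (x n) := by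
    rw [sigmaPerm_apply, E.symm_apply_apply, mul_one]
  rw [permCoord, e, hinj.extend_apply, id]

variable [∀ n, TopologicalSpace (G n)]

theorem continuous_permCoord : Continuous (permCoord E) :=
  continuous_pi fun n => Continuous.comp
    (g := Function.extend (fun h : G n => E ⟨n, h⟩) id 1)
    continuous_of_discreteTopology (continuous_perm_apply _)

theorem continuous_sigmaPerm [∀ n, DiscreteTopology (G n)] : Continuous (sigmaPerm E) :=
  continuous_induced_rng.2 <| continuous_pi fun k => Continuous.comp
    (g := fun h => E ⟨(E.symm k).1, h * (E.symm k).2⟩)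
    continuous_of_discreteTopology (continuous_apply (E.symm k).1)

/-- A continuous left inverse makes the range closed, as the set of fixed points of a continuous map
into a Hausdorff space; images then become preimages cut down to a closed set. -/
theorem IsPi03.image_sigmaPerm [∀ n, DiscreteTopology (G n)] {A : Set (∀ n, G n)}
    (hA : IsPi03 A) : IsPi03 (sigmaPerm E '' A) := by
  have e : sigmaPerm E '' A = permCoord E ⁻¹' A ∩ {σ | sigmaPerm E (permCoord E σ) = σ} := by
    ext σ
    constructor
    · rintro ⟨x, hx, rfl⟩
      simpa only [Set.mem_inter_iff, Set.mem_preimage, Set.mem_ofPred_eq, permCoord_sigmaPerm,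
        and_true] using hx
    · rintro ⟨h1, h2⟩
      exact ⟨_, h1, h2⟩
  rw [e]
  exact (hA.preimage (continuous_permCoord E)).inter_isClosed
    (isClosed_eq ((continuous_sigmaPerm E).comp (continuous_permCoord E)) continuous_id)

end PermutationAction

instance {α : Type*} [Countable α] : Countable (FreeGroup α) :=
  Quot.mk_surjective.countable

namespace Baire

instance (n : ℕ) : Countable (level n) := by
  refine Function.Injective.countable (f := fun (x : level n) (i : Fin n) => (x : Baire) i) ?_
  intro x y h
  refine Subtype.ext (funext fun i => ?_)
  rcases lt_or_ge i n with hi | hi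
  · exact congrFun h ⟨i, hi⟩
  · rw [x.2 i hi, y.2 i hi]

instance : Countable levelOmega :=
  (Set.countable_iUnion fun n => Set.to_countable (level n)).to_subtype

theorem nonempty_sigma_equiv_nat : Nonempty ((Σ n, FreeGroup (level n)) ≃ ℕ) := by
  have : Infinite (Σ n, FreeGroup (level n)) :=
    Infinite.of_injective (fun n => ⟨n, 1⟩) fun m n h => congrArg Sigma.fst h
  exact nonempty_equiv_of_countable

theorem exists_perm_subgroup : ∃ H : Subgroup (Equiv.Perm ℕ), IsPi03 (H : Set (Equiv.Perm ℕ)) ∧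
    ∃ φ : FBar gammaZero ≃* H, Continuous φ := by
  obtain ⟨E⟩ := nonempty_sigma_equiv_nat
  set χ := (sigmaPerm E).comp (MonoidHom.pi projBar) with hχ
  have hinj : Function.Injective χ := by
    intro g h e
    have e1 := congrArg (permCoord E) e
    simp only [hχ, MonoidHom.comp_apply, permCoord_sigmaPerm] at e1
    exact injective_toInvLimit (Subtype.ext e1)
  have hcont : Continuous χ := (continuous_sigmaPerm E).comp (continuous_pi continuous_projBar)
  refine ⟨χ.range, ?_, MonoidHom.ofInjective hinj, ?_⟩
  · have e : (χ.range : Set (Equiv.Perm ℕ)) =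
        sigmaPerm E '' {x | ∃ g, ∀ n, projBar n g = x n} := by
      ext σ
      constructor
      · rintro ⟨g, rfl⟩
        exact ⟨_, ⟨g, fun n => rfl⟩, rfl⟩
      · rintro ⟨x, ⟨g, hg⟩, rfl⟩
        exact ⟨g, congrArg (sigmaPerm E) (funext hg)⟩
    rw [e]
    exact isPi03_range_projBar.image_sigmaPerm E
  · exact hcont.subtype_mk _

end Baire

/-! ### Length functions with controlled conjugation -/

/-- A length function that induces the topology of a group and for which conjugation by `g i` is
Lipschitz with a constant that is exponential in `i`. -/
structure ConjLength {H : Type*} [Group H] [TopologicalSpace H] (g : ℕ → H) where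
  len : H → ℝ≥0
  len_one : len 1 = 0
  len_inv : ∀ h, len h⁻¹ = len h
  len_mul_le : ∀ h k, len (h * k) ≤ len h + len k
  -- This bound starts the coding, where the trivial approximation 1 must be within 2^{-4} of every
  -- point. It also handles letters at distance 1.
  len_le : ∀ h, len h ≤ (1 / 2) ^ 4
  eventually_lt : ∀ ε > 0, ∀ᶠ h in 𝓝 1, len h < ε
  exists_lt_imp : ∀ U ∈ 𝓝 (1 : H), ∃ ε > 0, ∀ h, len h < ε → h ∈ U
  len_conj_le : ∀ i h, len ((g i)⁻¹ * h * g i) ≤ 2 ^ 5 * 2 ^ i * len h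
  len_conj_inv_le : ∀ i h, len (g i * h * (g i)⁻¹) ≤ 2 ^ 5 * 2 ^ i * len h

section ConjLength

variable {H : Type*} [Group H]

/-- The distance is an infimum over chains, and left translation carries chains to chains of the
same cost. -/
theorem dist_ofPreNNDist_mul_left_le (p : H → ℝ≥0) (h1 : ∀ x : H, p (x⁻¹ * x) = 0)
    (h2 : ∀ x y : H, p (x⁻¹ * y) = p (y⁻¹ * x)) (g x y : H) :
    letI := PseudoMetricSpace.ofPreNNDist (fun x y => p (x⁻¹ * y)) h1 h2
    dist (g * x) (g * y) ≤ dist x y := by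
  rw [PseudoMetricSpace.dist_ofPreNNDist, PseudoMetricSpace.dist_ofPreNNDist, NNReal.coe_le_coe]
  refine le_ciInf fun l => (ciInf_le (OrderBot.bddBelow _) (l.map (g * ·))).trans_eq ?_
  have e1 : g * x :: l.map (g * ·) = (x :: l).map (g * ·) := rfl
  have e2 : l.map (g * ·) ++ [g * y] = (l ++ [y]).map (g * ·) := by simp
  rw [e1, e2, List.zipWith_map]
  congr 2
  funext a b
  rw [mul_inv_rev, mul_assoc, inv_mul_cancel_left]

/-- A sequence of symmetric sets, each containing the triple product of the next one, yields a
length function. -/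
theorem exists_length_of_sequence {U : ℕ → Set H}
    (hone : ∀ n, 1 ∈ U n) (hinv : ∀ n, ∀ h ∈ U n, h⁻¹ ∈ U n)
    (hmul : ∀ n, ∀ a ∈ U (n + 1), ∀ b ∈ U (n + 1), ∀ c ∈ U (n + 1), a * b * c ∈ U n) :
    ∃ p len : H → ℝ≥0, (∀ n h, p h < (1 / 2) ^ n ↔ h ∈ U n) ∧
      (∀ h, p h ≠ 0 → ∃ n, h ∉ U n ∧ p h = (1 / 2) ^ n) ∧
      (∀ h, len h ≤ p h) ∧ (∀ h, p h ≤ 2 * len h) ∧ len 1 = 0 ∧ (∀ h, len h⁻¹ = len h) ∧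
      ∀ h k, len (h * k) ≤ len h + len k := by
  classical
  have hanti : Antitone U := antitone_nat_of_succ_le fun n a ha => by
    simpa using hmul n a ha 1 (hone _) 1 (hone _)
  have hr : (1 / 2 : ℝ≥0) < 1 := by simpa using NNReal.half_lt_self (one_ne_zero (α := ℝ≥0))
  have hr0 : (0 : ℝ≥0) < 1 / 2 := by positivity
  set p : H → ℝ≥0 := fun h => if hh : ∃ n, h ∉ U n then (1 / 2) ^ Nat.find hh else 0 with hp
  have hlt : ∀ n h, p h < (1 / 2) ^ n ↔ h ∈ U n := by
    intro n h
    simp only [hp]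
    split_ifs with hh
    · rw [(pow_right_strictAnti₀ hr0 hr).lt_iff_gt, Nat.lt_find_iff]
      exact ⟨fun H => not_not.1 (H n le_rfl), fun H m hm => not_not.2 (hanti hm H)⟩
    · push Not at hh
      simp only [hh, iff_true]
      positivity
  have hval : ∀ h, p h ≠ 0 → ∃ n, h ∉ U n ∧ p h = (1 / 2) ^ n := by
    intro h hne
    by_cases hh : ∃ n, h ∉ U n
    · exact ⟨Nat.find hh, Nat.find_spec hh, dif_pos hh⟩
    · exact absurd (dif_neg hh) hne
  have hpone : p 1 = 0 := dif_neg (by simpa using hone)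
  have hpinv : ∀ h, p h⁻¹ = p h := by
    have e : ∀ h n, h⁻¹ ∈ U n ↔ h ∈ U n := fun h n =>
      ⟨fun H => by simpa using hinv n _ H, hinv n h⟩
    intro h
    simp only [hp, e]
  have h1 : ∀ x : H, p (x⁻¹ * x) = 0 := fun x => by rw [inv_mul_cancel, hpone]
  have h2 : ∀ x y : H, p (x⁻¹ * y) = p (y⁻¹ * x) := fun x y => by
    rw [← hpinv, mul_inv_rev, inv_inv]
  let I := PseudoMetricSpace.ofPreNNDist (fun x y => p (x⁻¹ * y)) h1 h2
  have hle : ∀ x y : H, dist x y ≤ p (x⁻¹ * y) := PseudoMetricSpace.dist_ofPreNNDist_le _ _ _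
  have hge : ∀ x y : H, p (x⁻¹ * y) ≤ 2 * dist x y := by
    -- Passing to chains costs at most a factor 2 if p of a triple product is at most twice the
    -- largest of the three values. This is the triple product hypothesis on the sets U n.
    refine PseudoMetricSpace.le_two_mul_dist_ofPreNNDist _ _ _ fun x₁ x₂ x₃ x₄ => ?_
    by_cases hne : p (x₁⁻¹ * x₄) = 0
    · rw [hne]
      exact zero_le
    obtain ⟨n, hn, e⟩ := hval _ hne
    by_contra! hc
    have hc' : max (p (x₁⁻¹ * x₂)) (max (p (x₂⁻¹ * x₃)) (p (x₃⁻¹ * x₄))) < (1 / 2) ^ (n + 1) := by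
      rw [e] at hc
      rw [pow_succ, mul_one_div, lt_div_iff₀ two_pos, mul_comm]
      exact hc
    simp only [max_lt_iff, hlt] at hc'
    refine hn ?_
    have := hmul n _ hc'.1 _ hc'.2.1 _ hc'.2.2
    rwa [show x₁⁻¹ * x₂ * (x₂⁻¹ * x₃) * (x₃⁻¹ * x₄) = x₁⁻¹ * x₄ by group] at this
  have hmulle : ∀ g x y : H, dist (g * x) (g * y) ≤ dist x y :=
    dist_ofPreNNDist_mul_left_le p h1 h2
  refine ⟨p, fun h => nndist 1 h, hlt, hval, fun h => ?_, fun h => ?_, nndist_self _, fun h => ?_,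
    fun h k => ?_⟩
  · have := hle 1 h
    rw [inv_one, one_mul] at this
    exact_mod_cast this
  · have := hge 1 h
    rw [inv_one, one_mul] at this
    exact_mod_cast this
  · have key : ∀ h : H, dist 1 h⁻¹ ≤ dist 1 h := fun h => by
      have := hmulle h⁻¹ h 1
      rwa [inv_mul_cancel, mul_one, dist_comm h] at this
    have h3 := key h⁻¹
    rw [inv_inv] at h3
    exact NNReal.coe_injective (le_antisymm (key h) h3)
  · have h3 := hmulle h 1 k
    rw [mul_one] at h3
    have := (dist_triangle 1 h (h * k)).trans (add_le_add_right h3 _)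
    exact_mod_cast this

variable [TopologicalSpace H] [IsTopologicalGroup H]

theorem exists_smaller_nhds_one (g : ℕ → H) (n : ℕ) {U B : Set H} (hU : U ∈ 𝓝 1) (hB : B ∈ 𝓝 1) :
    ∃ V ∈ 𝓝 (1 : H), (∀ h ∈ V, h⁻¹ ∈ V) ∧ V ⊆ B ∧
      (∀ a ∈ V, ∀ b ∈ V, ∀ c ∈ V, a * b * c ∈ U) ∧
      ∀ i ≤ n, ∀ h ∈ V, (g i)⁻¹ * h * g i ∈ U ∧ g i * h * (g i)⁻¹ ∈ U := by
  obtain ⟨V₁, hV₁o, hV₁, h₁⟩ := exists_open_nhds_one_split hU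
  obtain ⟨V₂, hV₂o, hV₂, h₂⟩ := exists_open_nhds_one_split (hV₁o.mem_nhds hV₁)
  have hconj : ∀ i ∈ Finset.range (n + 1),
      ∀ᶠ h in 𝓝 (1 : H), (g i)⁻¹ * h * g i ∈ U ∧ g i * h * (g i)⁻¹ ∈ U := by
    intro i _
    have c1 : Tendsto (fun h => (g i)⁻¹ * h * g i) (𝓝 1) (𝓝 1) := by
      have : Continuous fun h : H => (g i)⁻¹ * h * g i := by fun_prop
      simpa using this.tendsto 1
    have c2 : Tendsto (fun h => g i * h * (g i)⁻¹) (𝓝 1) (𝓝 1) := by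
      have : Continuous fun h : H => g i * h * (g i)⁻¹ := by fun_prop
      simpa using this.tendsto 1
    exact (c1.eventually hU).and (c2.eventually hU)
  have hconj' := (Finset.eventually_all (Finset.range (n + 1))).2 hconj
  set W : Set H := V₂ ∩ (V₁ ∩ (B ∩ {h | ∀ i ∈ Finset.range (n + 1),
    (g i)⁻¹ * h * g i ∈ U ∧ g i * h * (g i)⁻¹ ∈ U})) with hW
  have hWn : W ∈ 𝓝 1 := inter_mem (hV₂o.mem_nhds hV₂)
    (inter_mem (hV₁o.mem_nhds hV₁) (inter_mem hB hconj'))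
  refine ⟨W ∩ W⁻¹, inter_mem hWn (inv_mem_nhds_one H hWn), ?_, fun h hh => hh.1.2.2.1, ?_, ?_⟩
  · rintro h ⟨h3, h4⟩
    exact ⟨h4, by simpa using h3⟩
  · intro a ha b hb c hc
    exact h₁ _ (h₂ a ha.1.1 b hb.1.1) c hc.1.2.1
  · intro i hi h hh
    exact hh.1.2.2.2 i (Finset.mem_range_succ_iff.2 hi)

/-- The basic neighbourhoods shrink so fast that conjugation by g_0, …, g_n and their inverses maps
the (n+1)-st into the n-th. The sets with index below i are not controlled for g_i, which costs a
constant exponential in i. -/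
theorem nonempty_conjLength [FirstCountableTopology H] (g : ℕ → H) : Nonempty (ConjLength g) := by
  obtain ⟨B, hB⟩ := (𝓝 (1 : H)).exists_antitone_basis
  choose! V hV using fun (n : ℕ) (U : Set H) (hU : U ∈ 𝓝 (1 : H)) =>
    exists_smaller_nhds_one g n hU (hB.mem n)
  -- Starting from the whole group makes p < 1 everywhere; scaling by 2^{-4} then gives the bound
  -- required of the length.
  let U : ℕ → Set H := fun n => Nat.rec Set.univ V n
  have hUn : ∀ n, U n ∈ 𝓝 (1 : H) := by
    intro n
    induction n with
    | zero => exact univ_mem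
    | succ n ih => exact (hV n _ ih).1
  have spec : ∀ n, (∀ h ∈ U (n + 1), h⁻¹ ∈ U (n + 1)) ∧ U (n + 1) ⊆ B n ∧
      (∀ a ∈ U (n + 1), ∀ b ∈ U (n + 1), ∀ c ∈ U (n + 1), a * b * c ∈ U n) ∧
      ∀ i ≤ n, ∀ h ∈ U (n + 1), (g i)⁻¹ * h * g i ∈ U n ∧ g i * h * (g i)⁻¹ ∈ U n :=
    fun n => (hV n _ (hUn n)).2
  have hanti : Antitone U := antitone_nat_of_succ_le fun n a ha => by
    have h1 := mem_of_mem_nhds (hUn (n + 1))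
    simpa using (spec n).2.2.1 a ha 1 h1 1 h1
  obtain ⟨p, len, hlt, hval, hle, hge, hone, hinv, hmul⟩ := exists_length_of_sequence (U := U)
    (fun n => mem_of_mem_nhds (hUn n))
    (fun n => by
      cases n with
      | zero => exact fun _ _ => Set.mem_univ _
      | succ n => exact (spec n).1)
    (fun n => (spec n).2.2.1)
  have hp1 : ∀ h, p h < 1 := fun h => by simpa using (hlt 0 h).2 (Set.mem_univ h)
  have conj : ∀ (i : ℕ) (h k : H), (∀ n, i ≤ n → h ∈ U (n + 1) → k ∈ U n) →
      1 / 2 ^ 4 * len k ≤ 2 ^ 5 * 2 ^ i * (1 / 2 ^ 4 * len h) := by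
    intro i h k hk
    rw [mul_left_comm]
    refine mul_le_mul_right ?_ _
    refine (hle k).trans ?_
    by_cases hne : p k = 0
    · rw [hne]
      exact zero_le
    obtain ⟨n, hn, e⟩ := hval k hne
    -- The shift by i makes the hypothesis on conjugation applicable. It costs 2^{i+1}, and
    -- comparing p with the length costs another 2; the rest of 2^5 is slack.
    have h3 : ¬ p h < (1 / 2) ^ (n + i + 1) := fun hc =>
      hn (hanti (Nat.le_add_right n i) (hk (n + i) (Nat.le_add_left i n) ((hlt _ _).1 hc)))
    calc p k = 2 ^ (i + 1) * (1 / 2) ^ (n + i + 1) := by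
          rw [e, add_assoc, pow_add _ n, mul_left_comm, ← mul_pow]
          norm_num
      _ ≤ 2 ^ (i + 1) * (2 * len h) := mul_le_mul_right ((not_lt.1 h3).trans (hge h)) _
      _ = 2 ^ 2 * 2 ^ i * len h := by ring
      _ ≤ 2 ^ 5 * 2 ^ i * len h := by
        gcongr <;> norm_num
  refine ⟨⟨fun h => 1 / 2 ^ 4 * len h, by simp [hone], fun h => by simp only [hinv], fun h k => ?_,
    fun h => ?_, fun ε hε => ?_, fun W hW => ?_, fun i h => ?_, fun i h => ?_⟩⟩
  · rw [← mul_add]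
    exact mul_le_mul_right (hmul h k) _
  · rw [one_div_pow]
    exact mul_le_of_le_one_right zero_le ((hle h).trans (hp1 h).le)
  · obtain ⟨n, hn⟩ := exists_pow_lt_of_lt_one hε (by simpa using NNReal.half_lt_self one_ne_zero :
      (1 / 2 : ℝ≥0) < 1)
    filter_upwards [hUn n] with h hh
    refine lt_of_le_of_lt ?_ (((hlt n h).2 hh).trans hn)
    exact (mul_le_of_le_one_left zero_le ((div_le_one (by norm_num)).2 (by norm_num))).trans (hle h)
  · obtain ⟨n, -, hn⟩ := hB.toHasBasis.mem_iff.1 hW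
    refine ⟨1 / 2 ^ 5 * (1 / 2) ^ (n + 1), by positivity, fun h hh => hn ((spec n).2.1 ?_)⟩
    refine (hlt (n + 1) h).1 ?_
    refine (hge h).trans_lt ?_
    calc 2 * len h = 2 ^ 5 * (1 / 2 ^ 4 * len h) := by
          rw [← mul_assoc]
          norm_num
      _ < 2 ^ 5 * (1 / 2 ^ 5 * (1 / 2) ^ (n + 1)) := by gcongr
      _ = (1 / 2) ^ (n + 1) := by
        rw [← mul_assoc]
        norm_num
  · exact conj i h _ fun n hn hh => ((spec n).2.2.2 i hn h hh).1
  · exact conj i h _ fun n hn hh => ((spec n).2.2.2 i hn h hh).2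

/-! ### Two-sided completeness of Polish groups -/

/-- In a Polish group every filter that is Cauchy for both the left and the right uniformity
converges. -/
theorem exists_le_nhds_of_twoSided_cauchy [PolishSpace H] {F : Filter H} [F.NeBot]
    (hF : ∀ U ∈ 𝓝 (1 : H), ∃ s ∈ F, ∀ g ∈ s, ∀ h ∈ s, g⁻¹ * h ∈ U ∧ g * h⁻¹ ∈ U) :
    ∃ c, F ≤ 𝓝 c := by
  let := TopologicalSpace.upgradeIsCompletelyMetrizable H
  -- The metric is complete but need not be invariant. By the Baire category theorem some h lies in
  -- all these sets; then F translated by h is Cauchy for this metric, and its limit is translated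
  -- back by h⁻¹.
  let A : ℕ → Set H := fun k => {h | ∃ V ∈ 𝓝 h, ∃ s ∈ F, ∀ g ∈ s, ∀ g' ∈ s, ∀ v ∈ V,
    dist (g * v) (g' * v) < 1 / ((k : ℝ) + 1)}
  have hAo : ∀ k, IsOpen (A k) := by
    intro k
    refine isOpen_iff_mem_nhds.2 ?_
    rintro h ⟨V, hV, s, hs, hd⟩
    filter_upwards [eventually_mem_nhds_iff.2 hV] with h' hV'
    exact ⟨V, hV', s, hs, hd⟩
  have hAd : ∀ k, Dense (A k) := by
    intro k
    refine dense_iff_inter_open.2 fun V₀ hV₀ ⟨h₀, hh₀⟩ => ?_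
    have c1 : Tendsto (fun x => x * h₀) (𝓝 1) (𝓝 h₀) := by
      simpa using (continuous_mul_const h₀).tendsto 1
    obtain ⟨s, hs, hsU⟩ := hF _ (c1 (hV₀.mem_nhds hh₀))
    obtain ⟨m, hm⟩ := (inferInstance : F.NeBot).nonempty_of_mem hs
    have c2 : Tendsto (fun x : H × H => x.1 * x.2) (𝓝 1 ×ˢ 𝓝 (m * h₀)) (𝓝 (m * h₀)) := by
      have := (continuous_mul (M := H)).tendsto ((1 : H), m * h₀)
      rwa [one_mul, nhds_prod_eq] at this
    have hε : (0 : ℝ) < 1 / ((k : ℝ) + 1) / 2 := by positivity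
    obtain ⟨E, hE, W, hW, hEW⟩ := mem_prod_iff.1 (c2 (Metric.ball_mem_nhds _ hε))
    obtain ⟨t, ht, htE⟩ := hF E hE
    obtain ⟨n, hns, hnt⟩ := (inferInstance : F.NeBot).nonempty_of_mem (inter_mem hs ht)
    -- This point is near h₀ because n⁻¹m is near 1. For g in t its translate by g is near m h₀
    -- because gn⁻¹ is near 1. Both halves of the Cauchy condition are used.
    refine ⟨n⁻¹ * (m * h₀), ?_, (n * ·) ⁻¹' W, ?_, t, ht, fun g hg g' hg' v hv => ?_⟩
    · rw [← mul_assoc]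
      exact (hsU n hns m hm).1
    · refine (continuous_const_mul n).continuousAt.preimage_mem_nhds ?_
      rwa [mul_inv_cancel_left]
    · have key : ∀ g ∈ t, dist (g * v) (m * h₀) < 1 / ((k : ℝ) + 1) / 2 := fun g hg => by
        have := hEW (Set.mk_mem_prod (htE g hg n hnt).2 hv)
        simpa [mul_assoc] using this
      calc dist (g * v) (g' * v) ≤ _ := dist_triangle_right _ _ (m * h₀)
        _ < _ := add_lt_add (key g hg) (key g' hg')
        _ = _ := add_halves _
  obtain ⟨h, hh⟩ := (dense_iInter_of_isOpen_nat hAo hAd).nonempty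
  have hc : Cauchy (F.map (· * h)) := by
    refine Metric.cauchy_iff.2 ⟨inferInstance, fun ε hε => ?_⟩
    obtain ⟨k, hk⟩ := exists_nat_one_div_lt hε
    obtain ⟨V, hV, s, hs, hd⟩ := Set.mem_iInter.1 hh k
    refine ⟨(· * h) '' s, image_mem_map hs, ?_⟩
    rintro _ ⟨g, hg, rfl⟩ _ ⟨g', hg', rfl⟩
    exact (hd g hg g' hg' h (mem_of_mem_nhds hV)).trans hk
  obtain ⟨c, hc⟩ := CompleteSpace.complete hc
  have h3 : Tendsto (fun g => g * h * h⁻¹) F (𝓝 (c * h⁻¹)) :=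
    Tendsto.mul_const h⁻¹ (f := fun g => g * h) hc
  simp only [mul_inv_cancel_right] at h3
  exact ⟨c * h⁻¹, h3⟩

end ConjLength

/-! ### Coding points of a Polish group by sequences -/

namespace ConjLength

variable {H : Type*} [Group H] [TopologicalSpace H] {g : ℕ → H} (c : ConjLength g)

/-- Two elements are `ε`-close for both the left and the right invariant distance. -/
def Close (ε : ℝ≥0) (a b : H) : Prop := c.len (a⁻¹ * b) ≤ ε ∧ c.len (a * b⁻¹) ≤ ε

variable {c}

theorem Close.refl (a : H) : c.Close 0 a a := by
  simp [Close, c.len_one]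

theorem Close.symm {ε : ℝ≥0} {a b : H} (h : c.Close ε a b) : c.Close ε b a := by
  refine ⟨?_, ?_⟩
  · rw [← c.len_inv, mul_inv_rev, inv_inv]
    exact h.1
  · rw [← c.len_inv, mul_inv_rev, inv_inv]
    exact h.2

theorem Close.mono {ε η : ℝ≥0} {a b : H} (h : c.Close ε a b) (hε : ε ≤ η) : c.Close η a b :=
  ⟨h.1.trans hε, h.2.trans hε⟩

theorem Close.trans {ε η : ℝ≥0} {a b d : H} (h : c.Close ε a b) (k : c.Close η b d) :
    c.Close (ε + η) a d := by
  constructor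
  · have := (c.len_mul_le _ _).trans (add_le_add h.1 k.1)
    rwa [show a⁻¹ * b * (b⁻¹ * d) = a⁻¹ * d by group] at this
  · have := (c.len_mul_le _ _).trans (add_le_add h.2 k.2)
    rwa [show a * b⁻¹ * (b * d⁻¹) = a * d⁻¹ by group] at this

theorem eventually_close [IsTopologicalGroup H] (h : H) {ε : ℝ≥0} (hε : 0 < ε) :
    ∀ᶠ a in 𝓝 h, c.Close ε a h := by
  have c1 : Tendsto (fun a => a⁻¹ * h) (𝓝 h) (𝓝 1) := by
    have : Continuous fun a : H => a⁻¹ * h := by fun_prop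
    simpa using this.tendsto h
  have c2 : Tendsto (fun a => a * h⁻¹) (𝓝 h) (𝓝 1) := by
    simpa using (continuous_mul_const h⁻¹).tendsto h
  filter_upwards [c1.eventually (c.eventually_lt ε hε), c2.eventually (c.eventually_lt ε hε)]
    with a h1 h2
  exact ⟨h1.le, h2.le⟩

/-- If `b` is close to `a`, conjugation by `b` is close to conjugation by `a`. -/
theorem Close.len_conj_le {ε : ℝ≥0} {a b : H} (h : c.Close ε a b) (k : H) :
    c.len (b⁻¹ * k * b) ≤ c.len (a⁻¹ * k * a) + (ε + ε) := by
  calc c.len (b⁻¹ * k * b) = c.len (b⁻¹ * a * (a⁻¹ * k * a) * (a⁻¹ * b)) := by congr 1; group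
    _ ≤ c.len (b⁻¹ * a) + c.len (a⁻¹ * k * a) + c.len (a⁻¹ * b) :=
      (c.len_mul_le _ _).trans (add_le_add_left (c.len_mul_le _ _) _)
    _ ≤ ε + c.len (a⁻¹ * k * a) + ε :=
      add_le_add (add_le_add_left h.symm.1 _) h.1
    _ = _ := by ring

theorem Close.inv {ε : ℝ≥0} {a b : H} (h : c.Close ε a b) : c.Close ε a⁻¹ b⁻¹ :=
  ⟨by rw [inv_inv]; exact h.2, by rw [inv_inv]; exact h.1⟩

open Classical in
/-- The `n`-th approximation of the point of `H` coded by a sequence. -/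
def approx (c : ConjLength g) : ℕ → Baire → H
  | 0, _ => 1
  | n + 1, x =>
    -- Zero entries are ignored, as in the recursion for Γ₀. Replacing the conjugator costs twice
    -- 2^{-(n+3)}, within the additive constant 2^{-(n+1)} of that recursion.
    if x n ≠ 0 ∧ c.Close ((1 / 2) ^ (n + 3)) (approx c n x) (g (∑ i ∈ Finset.range (n + 1), x i))
    then g (∑ i ∈ Finset.range (n + 1), x i) else approx c n x

theorem approx_succ_of_eq {n : ℕ} {x : Baire} (h : x n = 0) :
    c.approx (n + 1) x = c.approx n x := by
  rw [approx, if_neg fun hc => hc.1 h]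

theorem approx_congr {n : ℕ} {x y : Baire} (h : ∀ i < n, x i = y i) :
    c.approx n x = c.approx n y := by
  induction n with
  | zero => rfl
  | succ n ih =>
    have e : ∑ i ∈ Finset.range (n + 1), x i = ∑ i ∈ Finset.range (n + 1), y i :=
      Finset.sum_congr rfl fun i hi => h i (Finset.mem_range.1 hi)
    rw [approx, approx, e, ih fun i hi => h i (hi.trans n.lt_succ_self), h n n.lt_succ_self]

theorem approx_of_mem {m n : ℕ} {x : Baire} (h : x ∈ Baire.level m) (hmn : m ≤ n) :
    c.approx n x = c.approx m x := by
  induction n, hmn using Nat.le_induction with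
  | base => rfl
  | succ n hmn ih => rw [approx_succ_of_eq (h n hmn), ih]

theorem close_approx_succ (n : ℕ) (x : Baire) :
    c.Close ((1 / 2) ^ (n + 3)) (c.approx n x) (c.approx (n + 1) x) := by
  rw [approx]
  split_ifs with h
  · exact h.2
  · exact (Close.refl _).mono zero_le

theorem close_approx {m n : ℕ} (h : m ≤ n) (x : Baire) :
    c.Close ((1 / 2) ^ (m + 2)) (c.approx m x) (c.approx n x) := by
  -- The induction carries the exact remainder of the geometric series.
  have key : ∃ ε, ε + (1 / 2) ^ (n + 2) = (1 / 2) ^ (m + 2) ∧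
      c.Close ε (c.approx m x) (c.approx n x) := by
    induction n, h using Nat.le_induction with
    | base => exact ⟨0, zero_add _, Close.refl _⟩
    | succ n hmn ih =>
      obtain ⟨ε, hε, hc⟩ := ih
      refine ⟨ε + (1 / 2) ^ (n + 3), ?_, hc.trans (close_approx_succ n x)⟩
      rw [add_assoc, add_right_comm n 1 2, Baire.half_pow_succ_add, hε]
  obtain ⟨ε, hε, hc⟩ := key
  exact hc.mono (hε ▸ le_self_add)

theorem close_approx_of_agree {k : ℕ} {x y : Baire} (h : ∀ i < k, x i = y i) (n : ℕ) :
    c.Close ((1 / 2) ^ (k + 1)) (c.approx n x) (c.approx n y) := by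
  rcases le_total k n with hk | hk
  · have h1 := close_approx (c := c) hk x
    have h2 := close_approx (c := c) hk y
    rw [← approx_congr h] at h2
    have := h1.symm.trans h2
    rwa [Baire.half_pow_succ_add] at this
  · rw [approx_congr (x := x) (y := y) fun i hi => h i (hi.trans_le hk)]
    exact (Close.refl _).mono zero_le

/-- If the entry is obeyed, the Lipschitz constant of the new element gives the linear branch and
closeness to the old approximation gives the additive one; otherwise the scale only grows. Both
directions are needed, for the letters x and x⁻¹. -/
theorem len_conj_approx_le (n : ℕ) (x : Baire) (k : H) :
    c.len ((c.approx n x)⁻¹ * k * c.approx n x) ≤ Baire.truncScale n x (c.len k) ∧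
      c.len (c.approx n x * k * (c.approx n x)⁻¹) ≤ Baire.truncScale n x (c.len k) := by
  induction n with
  | zero => simp [approx, Baire.truncScale_zero]
  | succ n ih =>
    by_cases h : x n ≠ 0 ∧
      c.Close ((1 / 2) ^ (n + 3)) (c.approx n x) (g (∑ i ∈ Finset.range (n + 1), x i))
    · have hs : 2 ^ 5 * 2 ^ (∑ i ∈ Finset.range (n + 1), x i) ≤ Baire.slope (n + 1) x := by
        rw [Baire.slope_succ]
        exact le_add_self
      have he : (1 / 2 : ℝ≥0) ^ (n + 3) + (1 / 2) ^ (n + 3) ≤ (1 / 2) ^ (n + 1) := by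
        rw [Baire.half_pow_succ_add (n + 2)]
        exact pow_le_pow_of_le_one zero_le (by simp) (by omega)
      rw [approx, if_pos h, Baire.truncScale_succ_of_ne h.1]
      constructor
      · refine le_min ((c.len_conj_le _ k).trans (mul_le_mul_left hs _)) ?_
        exact (h.2.len_conj_le k).trans (add_le_add ih.1 he)
      · refine le_min ((c.len_conj_inv_le _ k).trans (mul_le_mul_left hs _)) ?_
        have h1 := h.2.inv.len_conj_le k
        rw [inv_inv, inv_inv] at h1
        exact h1.trans (add_le_add ih.2 he)
    · rw [approx, if_neg h]
      exact ⟨ih.1.trans (Baire.truncScale_le_succ n x _), ih.2.trans (Baire.truncScale_le_succ n x _)⟩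

/-- The homomorphism on `F(𝒩_ω)` that sends a sequence to the point it codes. -/
def codeHom (c : ConjLength g) : FreeGroup Baire.levelOmega →* H :=
  FreeGroup.lift fun x => c.approx (Baire.rank x) x

theorem codeHom_of {n : ℕ} {x : Baire.levelOmega} (h : (x : Baire) ∈ Baire.level n) :
    c.codeHom (FreeGroup.of x) = c.approx n x := by
  rw [codeHom, FreeGroup.lift_apply_of, approx_of_mem (Baire.mem_level_rank x) (Baire.rank_le h)]

theorem close_codeHom (a b : Letter Baire.levelOmega) :
    c.Close (nndist a b) (c.codeHom a.toFree) (c.codeHom b.toFree) := by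
  have key (x y : Baire.levelOmega) :
      c.Close (nndist (Letter.pos (x : Baire)) (Letter.pos (y : Baire)))
        (c.codeHom (FreeGroup.of x)) (c.codeHom (FreeGroup.of y)) := by
    by_cases hxy : (x : Baire) = y
    · rw [Subtype.ext hxy]
      exact (Close.refl _).mono zero_le
    obtain ⟨m, hm⟩ := Baire.exists_mem_level x
    obtain ⟨n, hn⟩ := Baire.exists_mem_level y
    rw [codeHom_of (Baire.level_mono (le_max_left m n) hm),
      codeHom_of (Baire.level_mono (le_max_right m n) hn), Baire.nndist_pos_eq hxy]
    exact (close_approx_of_agree (fun i hi => PiNat.apply_eq_of_lt_firstDiff hi) _).mono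
      (pow_le_pow_of_le_one zero_le (by simp) (Nat.le_succ _))
  have near_one (a : Letter Baire.levelOmega) : c.Close (1 / 2) (c.codeHom a.toFree) 1 := by
    have h4 : (1 / 2 : ℝ≥0) ^ 4 ≤ 1 / 2 := by
      conv_rhs => rw [← pow_one (1 / 2 : ℝ≥0)]
      exact pow_le_pow_of_le_one zero_le (by simp) (by norm_num)
    exact ⟨(c.len_le _).trans h4, (c.len_le _).trans h4⟩
  have far (h : nndist a b = 1) :
      c.Close (nndist a b) (c.codeHom a.toFree) (c.codeHom b.toFree) := by
    rw [h, ← add_halves (1 : ℝ≥0)]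
    exact (near_one a).trans (near_one b).symm
  cases a <;> cases b <;>
    first
    | exact (Close.refl _).mono zero_le
    | exact far (NNReal.coe_injective rfl)
    | exact key _ _
    | exact (by rw [Letter.toFree, Letter.toFree, map_inv, map_inv]; exact (key _ _).inv)

theorem len_codeHom_le (w : FreeGroup Baire.levelOmega) :
    c.len (c.codeHom w) ≤ wordNorm Baire.gammaZero w := by
  refine le_wordNorm (L := fun w => c.len (c.codeHom w)) (fun v w => ?_) (fun a b => ?_)
    (fun a w => ?_) w
  · rw [map_mul]
    exact c.len_mul_le _ _
  · rw [map_mul, map_inv]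
    exact (close_codeHom a b).1
  · have key (x : Baire.levelOmega) :=
      len_conj_approx_le (c := c) (Baire.rank x) x (c.codeHom w)
    simp only [← codeHom_of (Baire.mem_level_rank _),
      ← Baire.gammaZero_pos (Baire.mem_level_rank _)] at key
    rw [map_mul, map_mul, map_inv]
    cases a with
    | e => simp [Letter.toFree, Baire.gammaZero_e]
    | pos x => exact (key x).1
    | neg x =>
      rw [Letter.toFree, map_inv, inv_inv]
      exact (key x).2

/-- The metric Δ controls both v⁻¹w and vw⁻¹, so Cauchy filters have images that are Cauchy on both
sides. -/
theorem exists_extension_codeHom [IsTopologicalGroup H] [PolishSpace H] (c : ConjLength g) :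
    ∃ Φ : FBar Baire.gammaZero →* H, Continuous Φ ∧
      ∀ w, Φ (FBar.ofFree Baire.gammaZero w) = c.codeHom w := by
  refine FBar.exists_extension _ _ fun F hF => ?_
  have := hF.1
  refine exists_le_nhds_of_twoSided_cauchy fun U hU => ?_
  obtain ⟨ε, hε, hεU⟩ := c.exists_lt_imp U hU
  obtain ⟨s, hs, hd⟩ := (Metric.cauchy_iff.1 hF).2 ε (by exact_mod_cast hε)
  refine ⟨_, image_mem_map hs, ?_⟩
  rintro _ ⟨v, hv, rfl⟩ _ ⟨w, hw, rfl⟩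
  have h := (dist_lt_iff Baire.gammaZero v w ε).1 (hd v hv w hw)
  refine ⟨hεU _ ?_, hεU _ ?_⟩
  · rw [← map_inv, ← map_mul]
    exact (len_codeHom_le _).trans_lt h.1
  · have h2 := h.2
    rw [scaleDelta, inv_inv] at h2
    rw [← map_inv, ← map_mul]
    exact (len_codeHom_le _).trans_lt h2

/-- Increasing indices t(n) are chosen with g at t(n+1) ever closer to h, and the entries are the
increments of t. They are positive, and their partial sums recover the indices, so every entry is
obeyed. -/
theorem exists_code [IsTopologicalGroup H]
    (hg : ∀ h : H, ∀ U ∈ 𝓝 h, ∀ s, ∃ i > s, g i ∈ U) (h : H) :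
    ∃ x : Baire, ∀ n, c.Close ((1 / 2) ^ (n + 4)) (c.approx n x) h := by
  have step : ∀ n t, ∃ i > t, c.Close ((1 / 2) ^ (n + 5)) (g i) h := fun n t =>
    hg h _ (eventually_close h (by positivity)) t
  choose f hf using step
  let t : ℕ → ℕ := fun n => Nat.rec 0 f n
  have ht : ∀ n, t n < t (n + 1) := fun n => (hf n (t n)).1
  have hx : ∀ n, ∑ i ∈ Finset.range n, (t (i + 1) - t i) = t n := fun n => by
    rw [Finset.sum_range_tsub (strictMono_nat_of_lt_succ ht).monotone]
    exact Nat.sub_zero _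
  refine ⟨fun n => t (n + 1) - t n, fun n => ?_⟩
  induction n with
  | zero => exact ⟨c.len_le _, c.len_le _⟩
  | succ n ih =>
    have h1 := (hf n (t n)).2
    -- The acceptance test passes through h, since 2^{-(n+4)} + 2^{-(n+5)} ≤ 2^{-(n+3)}.
    have h2 : c.Close ((1 / 2) ^ (n + 3)) (c.approx n fun n => t (n + 1) - t n) (g (t (n + 1))) := by
      rw [← Baire.half_pow_succ_add (n + 3)]
      exact (ih.trans h1.symm).mono (add_le_add_right
        (pow_le_pow_of_le_one zero_le (by simp) (Nat.le_succ _)) _)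
    rw [approx, if_pos ⟨(Nat.sub_pos_of_lt (ht n)).ne', by rwa [hx]⟩, hx]
    exact h1.mono (pow_le_pow_of_le_one zero_le (by simp) (by omega))

theorem tendsto_of_close {u : ℕ → H} {h : H} [IsTopologicalGroup H]
    (hu : ∀ n, c.Close ((1 / 2) ^ (n + 4)) (u n) h) : Tendsto u atTop (𝓝 h) := by
  have key : Tendsto (fun n => (u n)⁻¹ * h) atTop (𝓝 1) := by
    intro U hU
    obtain ⟨ε, hε, hεU⟩ := c.exists_lt_imp U hU
    obtain ⟨k, hk⟩ := exists_pow_lt_of_lt_one hε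
      (by simpa using NNReal.half_lt_self one_ne_zero : (1 / 2 : ℝ≥0) < 1)
    refine mem_map.2 ?_
    filter_upwards [eventually_ge_atTop k] with n hn
    refine hεU _ ((hu n).1.trans_lt (lt_of_le_of_lt ?_ hk))
    exact pow_le_pow_of_le_one zero_le (by simp) (by omega)
  have := (key.inv).const_mul h
  simpa using this

end ConjLength

/-- Codes use strictly increasing indices, so each term of a dense sequence is repeated infinitely
often by means of the pairing function. -/
theorem exists_frequent_dense_seq (H : Type*) [TopologicalSpace H]
    [TopologicalSpace.SeparableSpace H] [Nonempty H] :
    ∃ g : ℕ → H, ∀ h : H, ∀ U ∈ 𝓝 h, ∀ s, ∃ i > s, g i ∈ U := by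
  refine ⟨fun i => TopologicalSpace.denseSeq H i.unpair.1, fun h U hU s => ?_⟩
  obtain ⟨_, hx, j, rfl⟩ :=
    mem_closure_iff_nhds.1 (TopologicalSpace.denseRange_denseSeq H h) U hU
  refine ⟨Nat.pair j (s + 1), Nat.right_le_pair j (s + 1), ?_⟩
  simpa using hx

/-! ### Surjective universality -/

namespace Baire

theorem bigDelta_of_le (x y : levelOmega) : bigDelta gammaZero (FreeGroup.of x) (FreeGroup.of y) ≤
    nndist (Letter.pos (x : Baire)) (Letter.pos (y : Baire)) := by
  refine max_le (wordNorm_div_le gammaZero (Letter.pos x) (Letter.pos y)) ?_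
  refine (wordNorm_div_le gammaZero (Letter.neg x) (Letter.neg y)).trans_eq ?_
  exact NNReal.coe_injective rfl

theorem cauchySeq_ofFree_truncOmega (x : Baire) :
    CauchySeq fun n => FBar.ofFree gammaZero (FreeGroup.of (truncOmega n x)) := by
  refine cauchySeq_of_le_tendsto_0 (fun n => (((1 / 2 : ℝ≥0) ^ n : ℝ≥0) : ℝ))
    (fun n m N hn hm => ?_) ?_
  · rw [FBar.dist_ofFree, NNReal.coe_le_coe]
    refine (bigDelta_of_le _ _).trans (nndist_pos_le fun i hi => ?_)
    simp [truncOmega, trunc, hi.trans_le hn, hi.trans_le hm]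
  · push_cast
    exact tendsto_pow_atTop_nhds_zero_of_lt_one (by norm_num) (by norm_num)

theorem exists_surjective_hom (H : Type*) [Group H] [TopologicalSpace H] [IsTopologicalGroup H]
    [PolishSpace H] : ∃ Φ : FBar gammaZero →* H, Continuous Φ ∧ Function.Surjective Φ := by
  obtain ⟨g, hg⟩ := exists_frequent_dense_seq H
  obtain ⟨c⟩ := nonempty_conjLength g
  obtain ⟨Φ, hΦ, hof⟩ := c.exists_extension_codeHom
  refine ⟨Φ, hΦ, fun h => ?_⟩
  obtain ⟨x, hx⟩ := ConjLength.exists_code (c := c) hg h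
  -- The code x need not lie in 𝒩_ω, but its truncations form a Cauchy sequence of generators. The
  -- limit maps to the limit of the approximations, which is h.
  obtain ⟨a, ha⟩ := cauchySeq_tendsto_of_complete (cauchySeq_ofFree_truncOmega x)
  refine ⟨a, tendsto_nhds_unique ((hΦ.tendsto a).comp ha) ?_⟩
  have e : Φ ∘ (fun n => FBar.ofFree gammaZero (FreeGroup.of (truncOmega n x))) =
      fun n => c.approx n x := by
    funext n
    rw [Function.comp_apply, hof, ConjLength.codeHom_of (trunc_mem_level n x)]
    exact ConjLength.approx_congr fun i hi => by simp [truncOmega, trunc, hi]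
  rw [e]
  exact ConjLength.tendsto_of_close hx

theorem polishSpace_FBar : PolishSpace (FBar gammaZero) := by
  have : Countable (FreeGroup levelOmega) := inferInstance
  have : TopologicalSpace.SeparableSpace (FBar gammaZero) :=
    ⟨Set.range (FBar.ofFree gammaZero), Set.countable_range _, FBar.denseRange_ofFree gammaZero⟩
  have : SecondCountableTopology (FBar gammaZero) :=
    UniformSpace.secondCountable_of_separable _
  infer_instance

theorem isSurjectivelyUniversal_FBar : IsSurjectivelyUniversal.{u} (FBar gammaZero) where
  isTopologicalGroup := inferInstance
  polishSpace := polishSpace_FBar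
  exists_surjective H := exists_surjective_hom H

end Baire

end

theorem mainTheorem6 :
    IsGood Baire.gammaZero ∧ IsAdequate Baire.gammaZero ∧
    (∀ a r, Baire.gammaZero a⁻¹ r = Baire.gammaZero a r) ∧
    Baire.CondS1 Baire.gammaZero 1 ∧ Baire.CondS2 Baire.gammaZero 1 ∧
    Baire.CondS3 Baire.gammaZero 1 ∧
    IsSurjectivelyUniversal.{u} (FBar Baire.gammaZero) ∧
    (∃ Γ : Scale Baire, Baire.IsRegular Γ ∧
      (∀ (a : Letter Baire.levelOmega) (r : ℝ≥0),
        Γ (a.map Subtype.val) r = Baire.gammaZero a r) ∧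
      ∀ (a : Letter Baire) (r : ℝ≥0),
        Tendsto (fun n => Baire.gammaZero (a.map (Baire.truncOmega n)) r) atTop (𝓝 (Γ a r))) ∧
    (∃ ψ : FBar Baire.gammaZero →* Baire.invLimit,
      Continuous ψ ∧ Function.Injective ψ ∧
      (∀ (w : FreeGroup Baire.levelOmega) (n : ℕ),
        (ψ (FBar.ofFree Baire.gammaZero w)).1 n =
          FreeGroup.map (fun x : Baire.levelOmega => Baire.truncLevel n x) w) ∧
      IsPi03 (Set.range ψ)) ∧
    ∃ H : Subgroup (Equiv.Perm ℕ), IsPi03 (H : Set (Equiv.Perm ℕ)) ∧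
      ∃ φ : FBar Baire.gammaZero ≃* H, Continuous φ :=
  ⟨Baire.isGood_gammaZero, Baire.isGood_gammaZero.isAdequate, Baire.gammaZero_inv,
    Baire.condS1_gammaZero, Baire.condS2_gammaZero, Baire.condS3_gammaZero,
    Baire.isSurjectivelyUniversal_FBar,
    ⟨Baire.gammaLim, Baire.isRegular_gammaLim, Baire.gammaLim_map_val,
      Baire.tendsto_gammaZero_truncOmega⟩,
    ⟨Baire.toInvLimit, Baire.continuous_toInvLimit, Baire.injective_toInvLimit,
      fun w n => Baire.projBar_ofFree n w, Baire.isPi03_range_toInvLimit⟩,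
    Baire.exists_perm_subgroup⟩
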